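/- **Theorem (Ruh–Vilms).** Let $M$ be a smooth $m$-dimensional Riemannian manifold (without boundary) and let $I: M\to\mathbf R^N$ be a smooth isometric immersion; put $p=N-m$. For $x\in M$ let $ev_x:\mathbf R^N\to T_xM$ be the adjoint of $dI_x$, and let $f: M\to \mathrm{Gr}_p(\mathbf R^N)$, $f(x)=\ker ev_x=(dI_x(T_xM))^{\perp}$, be the Gauss map, which sends $x$ to the normal space $N_xM$. Here $\mathrm{Gr}_p(\mathbf R^N)$ is the Grassmannian of $p$-dimensional linear subspaces of $\mathbf R^N$ with its standard Riemannian metric, namely the Hilbert–Schmidt inner product on $T_S\mathrm{Gr}_p(\mathbf R^N)=\mathrm{Hom}(S,S^\perp)$. Let $K$ be the second fundamental form of $I$ ($K_XY$ is the component normal to $M$ of the derivative of $dI(Y)$ in the direction $X$), and let $\mathbf n=\sum_i K_{e_i}e_i$ be the mean curvature vector, where $(e_i)$ is an orthonormal basis of the tangent space. Then $\mathbf n$ is parallel with respect to the normal connection (that is, for all $x\in M$ and $X\in T_xM$ the normal component of the derivative of $\mathbf n$ in the direction $X$ vanishes) if and only if $f$ is a harmonic map, that is, $f$ is smooth and its tension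 field $\tau(f)=\mathrm{tr}\,\nabla df$ (formed with the Levi-Civita connections of $M$ and of $\mathrm{Gr}_p(\mathbf R^N)$) vanishes. -/

import Mathlib

open scoped Manifold ContDiff RealInnerProductSpace

noncomputable section

/-! ## Riemannian manifolds and harmonic maps -/

namespace Riemannian

open Module
open scoped Bundle

section Maps

variable {E : Type*} [NormedAddCommGroup E] [NormedSpace ℝ E] [FiniteDimensional ℝ E]
  {M : Type*} [TopologicalSpace M] [ChartedSpace E M]
  {F : Type*} [NormedAddCommGroup F] [NormedSpace ℝ F] [FiniteDimensional ℝ F]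
  {M' : Type*} [TopologicalSpace M'] [ChartedSpace F M']

instance instFiniteDimensionalTangentSpace (x : M) :
    FiniteDimensional ℝ (TangentSpace 𝓘(ℝ, E) x) :=
  inferInstanceAs (FiniteDimensional ℝ E)

variable [Bundle.RiemannianBundle (fun x : M ↦ TangentSpace 𝓘(ℝ, E) x)]
  [Bundle.RiemannianBundle (fun x : M' ↦ TangentSpace 𝓘(ℝ, F) x)]

/-- The coefficient `g_y(∂_v, ∂_w)` of the Riemannian metric of `M` at the point with coordinates
`y` in the preferred chart at `x`, where `∂_v` is the coordinate vector field of that chart in the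
constant direction `v`. -/
def metricCoeff (x : M) (v w y : E) : ℝ :=
  ⟪mfderiv 𝓘(ℝ, E) 𝓘(ℝ, E) (extChartAt 𝓘(ℝ, E) x).symm y v,
    mfderiv 𝓘(ℝ, E) 𝓘(ℝ, E) (extChartAt 𝓘(ℝ, E) x).symm y w⟫

/-- The derivative `∂_u g(∂_v, ∂_w)` at `x`, in the preferred chart at `x`. -/
def metricCoeffDeriv (x : M) (u v w : E) : ℝ :=
  fderiv ℝ (metricCoeff x v w) (extChartAt 𝓘(ℝ, E) x x) u

/-- The Christoffel symbol at `x` of the Levi-Civita connection, in the preferred chart at `x`: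
the vector `∇_{∂_v} ∂_w = Γ(v, w)` which is determined by
`2 g(Γ(v, w), u) = ∂_v g(w, u) + ∂_w g(v, u) - ∂_u g(v, w)` for all `u`
(written out in an orthonormal basis of the tangent space). -/
def christoffel (x : M) (v w : E) : E :=
  let e := stdOrthonormalBasis ℝ (TangentSpace 𝓘(ℝ, E) x)
  ∑ k, ((metricCoeffDeriv x v w (e k) + metricCoeffDeriv x w v (e k)
    - metricCoeffDeriv (E := E) x (e k) v w) / 2) • (e k : E)

/-- The Hessian `∇df` of a map `f` of Riemannian manifolds, that is, the covariant derivative of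
`df`, a section of `T*M ⊗ f⁻¹TM'`, with respect to the two Levi-Civita connections. In local
coordinates it is `∂_v∂_w f - df(Γ(v, w)) + Γ'(df v, df w)`. -/
def mapHessian (f : M → M') (x : M) (v w : TangentSpace 𝓘(ℝ, E) x) :
    TangentSpace 𝓘(ℝ, F) (f x) :=
  let φ : E → F := writtenInExtChartAt 𝓘(ℝ, E) 𝓘(ℝ, F) x f
  let y : E := extChartAt 𝓘(ℝ, E) x x
  (fderiv ℝ (fderiv ℝ φ) y v w - fderiv ℝ φ y (christoffel x (v : E) (w : E))
    + christoffel (f x) (fderiv ℝ φ y v) (fderiv ℝ φ y w) : F)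

/-- The tension field `τ(f) = tr ∇df`. -/
def tensionField (f : M → M') (x : M) : TangentSpace 𝓘(ℝ, F) (f x) :=
  let e := stdOrthonormalBasis ℝ (TangentSpace 𝓘(ℝ, E) x)
  ∑ i, mapHessian (E := E) (F := F) f x (e i) (e i)

/-- A map of Riemannian manifolds is harmonic if it is smooth and its tension field vanishes. -/
def IsHarmonicMap (f : M → M') : Prop :=
  ContMDiff 𝓘(ℝ, E) 𝓘(ℝ, F) ∞ f ∧ ∀ x, tensionField (E := E) (F := F) f x = 0

end Maps

/-! ## Isometric immersions into a Euclidean space -/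

section Immersions

variable {E : Type*} [NormedAddCommGroup E] [NormedSpace ℝ E] [FiniteDimensional ℝ E]
  {M : Type*} [TopologicalSpace M] [ChartedSpace E M]
  [Bundle.RiemannianBundle (fun x : M ↦ TangentSpace 𝓘(ℝ, E) x)]
  {W : Type*} [NormedAddCommGroup W] [InnerProductSpace ℝ W] [FiniteDimensional ℝ W]

/-- The differential `dI_x : T_x M → W` of a map into a vector space. -/
def differential (I : M → W) (x : M) : TangentSpace 𝓘(ℝ, E) x →L[ℝ] W :=
  mfderiv 𝓘(ℝ, E) 𝓘(ℝ, W) I x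

/-- A smooth map whose differentials are isometric (hence injective). -/
structure IsIsometricImmersion (I : M → W) : Prop where
  contMDiff : ContMDiff 𝓘(ℝ, E) 𝓘(ℝ, W) ∞ I
  inner_eq (x : M) (v w : TangentSpace 𝓘(ℝ, E) x) :
    ⟪differential (E := E) I x v, differential (E := E) I x w⟫ = ⟪v, w⟫

/-- The normal space at `x`: the kernel of the adjoint `ev_x : W → T_x M` of `dI_x`. -/
def normalSpace (I : M → W) (x : M) : Submodule ℝ W :=
  LinearMap.ker (ContinuousLinearMap.adjoint (differential (E := E) I x)).toLinearMap

/-- The second fundamental form `K_v w`, the component normal to `M` of the derivative in the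
direction `v` of the `W`-valued function `dI(Y)`, where `Y` is a vector field with value `w` at `x`;
here `Y` is taken to be constant in the preferred chart at `x`, so that `dI(Y)` is the function
`y ↦ DÎ(y) w` for the local expression `Î` of `I`. -/
def secondFundamentalForm (I : M → W) (x : M) (v w : TangentSpace 𝓘(ℝ, E) x) : W :=
  let φ : E → W := I ∘ (extChartAt 𝓘(ℝ, E) x).symm
  (normalSpace (E := E) I x).starProjection
    (fderiv ℝ (fun y ↦ fderiv ℝ φ y w) (extChartAt 𝓘(ℝ, E) x x) v)

/-- The mean curvature vector `n = ∑ K_{e_i} e_i`, for an orthonormal basis `e_i` of `T_x M`. -/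
def meanCurvature (I : M → W) (x : M) : W :=
  let e := stdOrthonormalBasis ℝ (TangentSpace 𝓘(ℝ, E) x)
  ∑ i, secondFundamentalForm (E := E) I x (e i) (e i)

/-- The connection of the normal bundle: the normal component of the derivative of a normal field,
regarded as a `W`-valued function. -/
def normalConnection (I ξ : M → W) (x : M) (v : TangentSpace 𝓘(ℝ, E) x) : W :=
  (normalSpace (E := E) I x).starProjection (differential (E := E) ξ x v)

/-- The mean curvature vector is parallel with respect to the normal connection. -/
def HasParallelMeanCurvature (I : M → W) : Prop :=
  ∀ (x : M) (v : TangentSpace 𝓘(ℝ, E) x),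
    normalConnection (E := E) I (meanCurvature (E := E) I) x v = 0

theorem IsIsometricImmersion.finrank_normalSpace {I : M → W}
    (hI : IsIsometricImmersion (E := E) I) (x : M) :
    finrank ℝ E + finrank ℝ (normalSpace (E := E) I x) = finrank ℝ W := by
  have hinj : Function.Injective (differential (E := E) I x) := by
    rw [injective_iff_map_eq_zero]
    intro v hv
    have h := hI.inner_eq x v v
    rw [hv, inner_zero_left] at h
    exact inner_self_eq_zero.1 h.symm
  have h := (LinearMap.range (differential (E := E) I x).toLinearMap).finrank_add_finrank_orthogonal
  rw [LinearMap.finrank_range_of_inj hinj, ContinuousLinearMap.orthogonal_range] at h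
  exact h

end Immersions

end Riemannian

/-! ## The Grassmannian as a Riemannian manifold -/

/-- The Grassmannian of `p`-dimensional linear subspaces of `ℝ^N`. -/
def Gr (p N : ℕ) : Type :=
  {S : Submodule ℝ (EuclideanSpace ℝ (Fin N)) // Module.finrank ℝ S = p}

namespace Gr

open Module ContinuousLinearMap
open scoped InnerProduct

/-- The Hilbert-Schmidt inner product `tr(A* B) = ∑ ⟪A e_i, B e_i⟫` of linear maps, written with an
orthonormal basis `e_i`. -/
def hilbertSchmidt {U V ι : Type*} [NormedAddCommGroup U] [InnerProductSpace ℝ U]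
    [NormedAddCommGroup V] [InnerProductSpace ℝ V] [Fintype ι] (e : OrthonormalBasis ι ℝ U) :
    (U →L[ℝ] V) →L[ℝ] (U →L[ℝ] V) →L[ℝ] ℝ :=
  ∑ i, (innerSL ℝ).bilinearComp (ContinuousLinearMap.apply ℝ V (e i))
    (ContinuousLinearMap.apply ℝ V (e i))

theorem hilbertSchmidt_apply {U V ι : Type*} [NormedAddCommGroup U] [InnerProductSpace ℝ U]
    [NormedAddCommGroup V] [InnerProductSpace ℝ V] [Fintype ι] (e : OrthonormalBasis ι ℝ U)
    (A B : U →L[ℝ] V) : hilbertSchmidt e A B = ∑ i, ⟪A (e i), B (e i)⟫ := by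
  simp [hilbertSchmidt]

variable {p N : ℕ}

/-- The vector space `Hom(ℝ^p, ℝ^(N-p))` on which the Grassmannian is modelled. -/
abbrev Model (p N : ℕ) : Type :=
  EuclideanSpace ℝ (Fin p) →L[ℝ] EuclideanSpace ℝ (Fin (N - p))

theorem finrank_orthogonal (S : Gr p N) : finrank ℝ S.1ᗮ = N - p := by
  have h := S.1.finrank_add_finrank_orthogonal
  rw [S.2, finrank_euclideanSpace_fin] at h
  omega

/-- An orthonormal frame of the subspace `S`, as an isometric map `ℝ^p → ℝ^N` with image `S`. -/
def frame (S : Gr p N) : EuclideanSpace ℝ (Fin p) →L[ℝ] EuclideanSpace ℝ (Fin N) :=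
  S.1.subtypeL ∘L
    (((stdOrthonormalBasis ℝ S.1).reindex (finCongr S.2)).repr.symm :
      EuclideanSpace ℝ (Fin p) →L[ℝ] S.1)

/-- An orthonormal frame of `Sᗮ`, as an isometric map `ℝ^(N-p) → ℝ^N` with image `Sᗮ`. -/
def coframe (S : Gr p N) : EuclideanSpace ℝ (Fin (N - p)) →L[ℝ] EuclideanSpace ℝ (Fin N) :=
  S.1ᗮ.subtypeL ∘L
    (((stdOrthonormalBasis ℝ S.1ᗮ).reindex (finCongr S.finrank_orthogonal)).repr.symm :
      EuclideanSpace ℝ (Fin (N - p)) →L[ℝ] S.1ᗮ)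

theorem frame_mem (S : Gr p N) (v) : frame S v ∈ S.1 := by
  simp [frame]

theorem coframe_mem (S : Gr p N) (v) : coframe S v ∈ S.1ᗮ :=
  (((stdOrthonormalBasis ℝ S.1ᗮ).reindex (finCongr S.finrank_orthogonal)).repr.symm v).2

theorem range_frame (S : Gr p N) : LinearMap.range (frame S).toLinearMap = S.1 := by
  apply le_antisymm
  · rintro _ ⟨v, rfl⟩
    exact frame_mem S v
  · intro w hw
    exact ⟨((stdOrthonormalBasis ℝ S.1).reindex (finCongr S.2)).repr ⟨w, hw⟩, by simp [frame]⟩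

theorem exists_coframe (S : Gr p N) {w : EuclideanSpace ℝ (Fin N)} (hw : w ∈ S.1ᗮ) : ∃ v, coframe S v = w :=
  ⟨((stdOrthonormalBasis ℝ S.1ᗮ).reindex (finCongr S.finrank_orthogonal)).repr ⟨w, hw⟩,
    by simp [coframe]⟩

theorem inner_frame (S : Gr p N) (v w) : ⟪frame S v, frame S w⟫ = ⟪v, w⟫ := by
  simp [frame, ← Submodule.coe_inner]

theorem inner_coframe (S : Gr p N) (v w) : ⟪coframe S v, coframe S w⟫ = ⟪v, w⟫ := by
  simp only [coframe, coe_comp, Function.comp_apply, Submodule.subtypeL_apply,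
    ← Submodule.coe_inner]
  exact LinearIsometryEquiv.inner_map_map _ v w

theorem adjoint_frame_frame (S : Gr p N) : (frame S)† ∘L frame S = 1 := by
  ext1 v
  refine ext_inner_left ℝ fun w ↦ ?_
  simp [adjoint_inner_right, inner_frame]

theorem adjoint_coframe_coframe (S : Gr p N) : (coframe S)† ∘L coframe S = 1 := by
  ext1 v
  refine ext_inner_left ℝ fun w ↦ ?_
  simp [adjoint_inner_right, inner_coframe]

theorem adjoint_frame_coframe (S : Gr p N) : (frame S)† ∘L coframe S = 0 := by
  ext1 v
  refine ext_inner_left ℝ fun w ↦ ?_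
  simp [adjoint_inner_right, S.1.inner_right_of_mem_orthogonal (frame_mem S w) (coframe_mem S v)]

theorem adjoint_coframe_frame (S : Gr p N) : (coframe S)† ∘L frame S = 0 := by
  ext1 v
  refine ext_inner_left ℝ fun w ↦ ?_
  simp [adjoint_inner_right, S.1.inner_left_of_mem_orthogonal (frame_mem S v) (coframe_mem S w)]

theorem frame_adjoint_apply (S : Gr p N) {w : EuclideanSpace ℝ (Fin N)} (hw : w ∈ S.1) :
    frame S (((frame S)†) w) = w := by
  rw [← range_frame] at hw
  obtain ⟨v, rfl⟩ := hw
  exact congrArg (frame S) (DFunLike.congr_fun (adjoint_frame_frame S) v)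

theorem frame_add_coframe (S : Gr p N) :
    frame S ∘L (frame S)† + coframe S ∘L (coframe S)† = 1 := by
  ext1 w
  obtain ⟨x, hx, y, hy, rfl⟩ := S.1.exists_add_mem_mem_orthogonal w
  rw [← range_frame] at hx
  obtain ⟨v, rfl⟩ := hx
  obtain ⟨u, rfl⟩ := exists_coframe S hy
  have h1 := DFunLike.congr_fun (adjoint_frame_frame S) v
  have h2 := DFunLike.congr_fun (adjoint_coframe_coframe S) u
  have h3 := DFunLike.congr_fun (adjoint_coframe_frame S) v
  have h4 := DFunLike.congr_fun (adjoint_frame_coframe S) u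
  simp only [coe_comp, Function.comp_apply, one_apply_eq_self, zero_apply] at h1 h2 h3 h4
  simp [h1, h2, h3, h4]

/-- The injective map `v ↦ v + A v` from `S ≅ ℝ^p` to `S ⊕ Sᗮ = ℝ^N`, whose image is the graph
of `A`. -/
def graphMap (S : Gr p N) (A : Model p N) :
    EuclideanSpace ℝ (Fin p) →L[ℝ] EuclideanSpace ℝ (Fin N) :=
  frame S + coframe S ∘L A

theorem adjoint_frame_graphMap (S : Gr p N) (A : Model p N) :
    (frame S)† ∘L graphMap S A = 1 := by
  rw [graphMap, comp_add, adjoint_frame_frame, ← comp_assoc, adjoint_frame_coframe, zero_comp,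
    add_zero]

theorem adjoint_coframe_graphMap (S : Gr p N) (A : Model p N) :
    (coframe S)† ∘L graphMap S A = A := by
  rw [graphMap, comp_add, adjoint_coframe_frame, ← comp_assoc, adjoint_coframe_coframe, zero_add]
  rfl

theorem graphMap_injective (S : Gr p N) (A : Model p N) : Function.Injective (graphMap S A) := by
  intro v w h
  have h1 := DFunLike.congr_fun (adjoint_frame_graphMap S A) v
  have h2 := DFunLike.congr_fun (adjoint_frame_graphMap S A) w
  simp only [coe_comp, Function.comp_apply, one_apply_eq_self] at h1 h2
  rw [← h1, ← h2, h]

/-- The graph of a linear map `A : S → Sᗮ`, where `S ≅ ℝ^p` and `Sᗮ ≅ ℝ^(N-p)`. -/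
def graph (S : Gr p N) (A : Model p N) : Gr p N :=
  ⟨LinearMap.range (graphMap S A).toLinearMap, by
    rw [LinearMap.finrank_range_of_inj (graphMap_injective S A), finrank_euclideanSpace_fin]⟩

/-- The matrix of the orthogonal projection `T → S` in the orthonormal frames. It is invertible if
and only if `T ∩ Sᗮ = 0`. -/
def projS (S T : Gr p N) : EuclideanSpace ℝ (Fin p) →L[ℝ] EuclideanSpace ℝ (Fin p) :=
  (frame S)† ∘L frame T

/-- For `T` with `T ∩ Sᗮ = 0`, the linear map `S → Sᗮ` whose graph is `T`. -/
def slope (S T : Gr p N) : Model p N :=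
  ((coframe S)† ∘L frame T) ∘L Ring.inverse (projS S T)

theorem exists_graphMap_eq (S : Gr p N) (A : Model p N) :
    ∃ g : (EuclideanSpace ℝ (Fin p) →L[ℝ] EuclideanSpace ℝ (Fin p))ˣ,
      graphMap S A = frame (graph S A) ∘L g.1 := by
  set c := graphMap S A
  set t := frame (graph S A)
  have htc : t ∘L (t† ∘L c) = c := by
    ext1 v
    exact frame_adjoint_apply (graph S A) ⟨v, rfl⟩
  have h1 : ((frame S)† ∘L t) * (t† ∘L c) = 1 := by
    change ((frame S)† ∘L t) ∘L (t† ∘L c) = 1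
    rw [comp_assoc, htc, adjoint_frame_graphMap]
  have h2 : (t† ∘L c) * ((frame S)† ∘L t) = 1 := by
    have h : (t† ∘L c).toLinearMap * ((frame S)† ∘L t).toLinearMap = 1 := by
      apply mul_eq_one_comm.1
      ext1 v
      exact DFunLike.congr_fun h1 v
    ext1 v
    exact DFunLike.congr_fun h v
  exact ⟨⟨t† ∘L c, (frame S)† ∘L t, h2, h1⟩, htc.symm⟩

theorem isUnit_projS_graph (S S' : Gr p N) (A : Model p N) :
    IsUnit (projS S' (graph S A)) ↔ IsUnit ((frame S')† ∘L graphMap S A) := by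
  obtain ⟨g, hg⟩ := exists_graphMap_eq S A
  rw [hg, ← comp_assoc]
  exact (Units.isUnit_mul_units _ g).symm

theorem slope_graph (S S' : Gr p N) (A : Model p N) :
    slope S' (graph S A) =
      ((coframe S')† ∘L graphMap S A) ∘L Ring.inverse ((frame S')† ∘L graphMap S A) := by
  obtain ⟨g, hg⟩ := exists_graphMap_eq S A
  have h1 : g.1 ∘L Ring.inverse g.1 = ContinuousLinearMap.id ℝ _ :=
    Ring.mul_inverse_cancel _ g.isUnit
  have h2 : Ring.inverse (projS S' (graph S A) ∘L g.1) =
      Ring.inverse g.1 ∘L Ring.inverse (projS S' (graph S A)) :=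
    Ring.inverse_mul (.inr g.isUnit)
  have h3 : (frame S')† ∘L graphMap S A = projS S' (graph S A) ∘L g.1 := by
    rw [hg, projS, comp_assoc]
  rw [h3, h2, hg, slope, ← comp_assoc, comp_assoc _ _ (Ring.inverse g.1),
    comp_assoc _ g.1, h1, comp_id]

/-- The graph chart at `S`, identifying the linear maps `S → Sᗮ` with the subspaces `T` such that
`T ∩ Sᗮ = 0`. -/
def graphChart (S : Gr p N) : PartialEquiv (Gr p N) (Model p N) where
  toFun := slope S
  invFun := graph S
  source := {T | IsUnit (projS S T)}
  target := Set.univ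
  map_source' _ _ := trivial
  map_target' A _ := by
    change IsUnit _
    rw [isUnit_projS_graph, adjoint_frame_graphMap]
    exact isUnit_one
  left_inv' T hT := by
    have h : graphMap S (slope S T) ∘L projS S T = frame T := by
      have h1 : Ring.inverse (projS S T) ∘L projS S T = ContinuousLinearMap.id ℝ _ :=
        Ring.inverse_mul_cancel _ hT
      rw [graphMap, add_comp, slope, comp_assoc, comp_assoc, comp_assoc, h1, comp_id, projS]
      exact congrArg (· ∘L frame T) (frame_add_coframe S)
    have hle : T.1 ≤ (graph S (slope S T)).1 := by
      rw [← range_frame T, ← h]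
      rintro _ ⟨v, rfl⟩
      exact ⟨projS S T v, rfl⟩
    exact Subtype.ext (Submodule.eq_of_le_of_finrank_eq hle
      (T.2.trans (graph S (slope S T)).2.symm)).symm
  right_inv' A _ := by
    rw [slope_graph, adjoint_frame_graphMap, adjoint_coframe_graphMap, Ring.inverse_one]
    rfl

theorem transition_source (S S' : Gr p N) :
    ((graphChart S).symm.trans (graphChart S')).source =
      {A | IsUnit ((frame S')† ∘L graphMap S A)} := by
  ext A
  simp only [PartialEquiv.trans_source, PartialEquiv.symm_source, Set.mem_inter_iff,
    Set.mem_preimage]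
  exact (and_iff_right trivial).trans (isUnit_projS_graph S S' A)

theorem contDiff_graphMap (S : Gr p N) : ContDiff ℝ ∞ (graphMap S) := by
  unfold graphMap
  fun_prop

theorem isOpen_transition_source (S S' : Gr p N) :
    IsOpen ((graphChart S).symm.trans (graphChart S')).source := by
  rw [transition_source]
  exact Units.isOpen.preimage
    ((ContinuousLinearMap.compL ℝ _ _ _ ((frame S')†)).continuous.comp
      (contDiff_graphMap S).continuous)

theorem contDiffOn_transition (S S' : Gr p N) :
    ContDiffOn ℝ ∞ ((graphChart S).symm.trans (graphChart S'))
      ((graphChart S).symm.trans (graphChart S')).source := by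
  rw [transition_source]
  intro A hA
  apply ContDiffAt.contDiffWithinAt
  have h : ((graphChart S).symm.trans (graphChart S') : Model p N → Model p N) = fun A ↦
      ((coframe S')† ∘L graphMap S A) ∘L Ring.inverse ((frame S')† ∘L graphMap S A) :=
    funext (slope_graph S S')
  rw [h]
  have hg := (contDiff_graphMap S).contDiffAt (x := A)
  have h1 : ContDiffAt ℝ ∞ (fun A ↦ (frame S')† ∘L graphMap S A) A :=
    contDiffAt_const.clm_comp hg
  have h2 : ContDiffAt ℝ ∞ (fun A ↦ (coframe S')† ∘L graphMap S A) A :=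
    contDiffAt_const.clm_comp hg
  obtain ⟨u, hu⟩ := hA
  have h3 : ContDiffAt ℝ ∞ Ring.inverse ((frame S')† ∘L graphMap S A) := by
    rw [← hu]
    exact contDiffAt_ringInverse ℝ u
  exact h2.clm_comp (ContDiffAt.comp (g := Ring.inverse) A h3 h1)

variable (p N) in
/-- The atlas of graph charts. -/
def chartedSpaceCore : ChartedSpaceCore (Model p N) (Gr p N) where
  atlas := Set.range graphChart
  chartAt := graphChart
  mem_chart_source S := by
    change IsUnit _
    rw [projS, adjoint_frame_frame]
    exact isUnit_one
  chart_mem_atlas S := ⟨S, rfl⟩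
  open_source := by
    rintro _ _ ⟨S, rfl⟩ ⟨S', rfl⟩
    exact isOpen_transition_source S S'
  continuousOn_toFun := by
    rintro _ _ ⟨S, rfl⟩ ⟨S', rfl⟩
    exact (contDiffOn_transition S S').continuousOn

instance instTopologicalSpace : TopologicalSpace (Gr p N) :=
  (chartedSpaceCore p N).toTopologicalSpace

instance instChartedSpace : ChartedSpace (Model p N) (Gr p N) :=
  (chartedSpaceCore p N).toChartedSpace

instance instIsManifold : IsManifold 𝓘(ℝ, Model p N) ∞ (Gr p N) := by
  apply isManifold_of_contDiffOn
  intro e e' he he'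
  obtain ⟨_, ⟨S, rfl⟩, he⟩ := Set.mem_iUnion₂.1 he
  obtain ⟨_, ⟨S', rfl⟩, he'⟩ := Set.mem_iUnion₂.1 he'
  obtain rfl := Set.mem_singleton_iff.1 he
  obtain rfl := Set.mem_singleton_iff.1 he'
  refine (contDiffOn_transition S S').congr_mono (fun _ _ ↦ rfl) ?_
  exact Set.inter_subset_left

/-- The Hilbert-Schmidt inner product `tr(Aᵀ B)` on `Hom(ℝ^p, ℝ^(N-p))`. -/
def innerHS : Model p N →L[ℝ] Model p N →L[ℝ] ℝ :=
  hilbertSchmidt (EuclideanSpace.basisFun (Fin p) ℝ)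

theorem innerHS_apply (A B : Model p N) :
    innerHS A B = ∑ i, ⟪A (EuclideanSpace.basisFun (Fin p) ℝ i),
      B (EuclideanSpace.basisFun (Fin p) ℝ i)⟫ :=
  hilbertSchmidt_apply _ A B

theorem innerHS_symm (A B : Model p N) : innerHS A B = innerHS B A := by
  simp only [innerHS_apply, real_inner_comm]

theorem innerHS_pos {A : Model p N} (hA : A ≠ 0) : 0 < innerHS A A := by
  rw [innerHS_apply]
  refine lt_of_le_of_ne (Finset.sum_nonneg fun i _ ↦ real_inner_self_nonneg) fun h ↦ hA ?_
  have h' := (Finset.sum_eq_zero_iff_of_nonneg fun i _ ↦ real_inner_self_nonneg).1 h.symm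
  apply ContinuousLinearMap.coe_injective
  refine (EuclideanSpace.basisFun (Fin p) ℝ).toBasis.ext fun i ↦ ?_
  simpa using h' i (Finset.mem_univ i)

theorem norm_le_of_innerHS_lt_one {A : Model p N} (hA : innerHS A A < 1) : ‖A‖ ≤ p := by
  refine A.opNorm_le_bound p.cast_nonneg fun v ↦ ?_
  set e := EuclideanSpace.basisFun (Fin p) ℝ
  have hA' (i : Fin p) : ‖A (e i)‖ ≤ 1 := by
    rw [innerHS_apply] at hA
    have h := Finset.single_le_sum (f := fun i ↦ ⟪A (e i), A (e i)⟫)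
      (fun i _ ↦ real_inner_self_nonneg) (Finset.mem_univ i)
    rw [real_inner_self_eq_norm_sq] at h
    nlinarith [norm_nonneg (A (e i))]
  calc ‖A v‖ = ‖∑ i, e.repr v i • A (e i)‖ := by
        conv_lhs => rw [← e.sum_repr v, map_sum]
        simp only [map_smul]
    _ ≤ ∑ i : Fin p, ‖v‖ := by
        refine norm_sum_le_of_le _ fun i _ ↦ ?_
        rw [norm_smul]
        have h := (PiLp.norm_apply_le (e.repr v) i).trans_eq (e.repr.norm_map v)
        exact (mul_le_of_le_one_right (norm_nonneg _) (hA' i)).trans h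
    _ = p * ‖v‖ := by simp

theorem isVonNBounded_innerHS :
    Bornology.IsVonNBounded ℝ {A : Model p N | innerHS A A < 1} := by
  refine (NormedSpace.isVonNBounded_closedBall ℝ (Model p N) p).subset fun A hA ↦ ?_
  rw [mem_closedBall_zero_iff]
  exact norm_le_of_innerHS_lt_one hA

/-- The standard Riemannian metric of the Grassmannian. The tangent space at `S` is
`Hom(S, Sᗮ)`, identified with `Hom(ℝ^p, ℝ^(N-p))` by the chart at `S`, that is, by orthonormal
frames of `S` and `Sᗮ`; the metric is the Hilbert-Schmidt inner product. -/
def metric : Bundle.RiemannianMetric (fun S : Gr p N ↦ TangentSpace 𝓘(ℝ, Model p N) S) where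
  inner _ := (innerHS : Model p N →L[ℝ] Model p N →L[ℝ] ℝ)
  symm _ A B := innerHS_symm (p := p) (N := N) A B
  pos _ A hA := innerHS_pos (p := p) (N := N) hA
  continuousAt S := by
    change ContinuousAt (fun A : Model p N ↦ innerHS A A) 0
    fun_prop
  isVonNBounded _ := isVonNBounded_innerHS (p := p) (N := N)

instance instRiemannianBundle :
    Bundle.RiemannianBundle (fun S : Gr p N ↦ TangentSpace 𝓘(ℝ, Model p N) S) :=
  ⟨metric⟩

end Gr

/-! ## The Gauss map -/

namespace Riemannian

/-- The Gauss map `x ↦ ker ev_x` of an isometric immersion of an `m`-dimensional Riemannian manifold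
into `ℝ^N`, sending a point to its normal space, of dimension `p = N - m`. -/
def gaussMap {m p N : ℕ} (hN : m + p = N) {M : Type*} [TopologicalSpace M]
    [ChartedSpace (EuclideanSpace ℝ (Fin m)) M]
    [Bundle.RiemannianBundle
      (fun x : M ↦ TangentSpace 𝓘(ℝ, EuclideanSpace ℝ (Fin m)) x)]
    {I : M → EuclideanSpace ℝ (Fin N)}
    (hI : IsIsometricImmersion (E := EuclideanSpace ℝ (Fin m)) I) (x : M) : Gr p N :=
  ⟨normalSpace (E := EuclideanSpace ℝ (Fin m)) I x, by
    have h := hI.finrank_normalSpace x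
    rw [finrank_euclideanSpace_fin, finrank_euclideanSpace_fin] at h
    omega⟩

end Riemannian

end

open scoped Bundle

/-!
The Gauss map is studied in the chart at a point `x` of `M` and in the graph chart at the normal
space `S` at `x`. Let `φ` be the local expression of the immersion. Nearby normal spaces are the
graphs of linear maps `A y : S → Sᗮ`, which solve a linear equation with coefficients given by
`Dφ`. So the Gauss map is smooth (`contMDiff_gaussMap`).

The metric of the Grassmannian in the graph chart at `S` is an even function of the coordinates.
Hence the Christoffel symbols vanish at `S` (`Gr.christoffel_eq_zero`), and the tension field is the
Laplacian `τ = ∑ i, (D²A(e i, e i) - DA(Γ(e i, e i)))`, for an orthonormal basis `e i` of the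
tangent space at `x`. To compute it, fix `v ∈ S`. The field `ξ y = v + A y v` is normal, that is,
`⟪Dφ(u), ξ⟫ = 0` for all `u`. Differentiating this relation twice expresses `⟪Dφ(u), τ v⟫` by
derivatives of `φ` of order at most three. On the other hand the mean curvature vector `n` is the
normal component of the trace of `D²φ` with respect to the induced metric, and its derivative is
likewise an expression in these derivatives. As `D³φ` is symmetric, comparison gives
`⟪Dφ(u), τ v⟫ = - ⟪D n(u), v⟫` (`inner_laplacian_normal`, `inner_gaussTension`). Since `τ v` is
tangential, `τ` vanishes at `x` if and only if the normal component of `D n` does.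

Two points are specific to the definitions. The mean curvature vector at a point is defined in the
preferred chart and an arbitrary orthonormal basis at that point, so it has to be shown to agree
near `x` with a smooth expression in the single chart at `x`
(`IsIsometricImmersion.meanCurvature_eq`). The Christoffel symbols of `M` are found from the metric
induced by the immersion (`IsIsometricImmersion.christoffel_eq`).
-/

namespace Riemannian

open scoped InnerProduct
open ContinuousLinearMap Filter Topology Module

/-! ### Left inverses of injective linear maps -/

section LeftInverse

variable {E : Type*} [NormedAddCommGroup E] [InnerProductSpace ℝ E]
  {W : Type*} [NormedAddCommGroup W] [InnerProductSpace ℝ W]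
  {V : Type*} [NormedAddCommGroup V] [NormedSpace ℝ V]
  {ι κ : Type*} [Fintype ι] [Fintype κ]

/-- The sum is the orthogonal projection of `w` to the range of `L`, expanded in the orthonormal
frame `L (b i)`. -/
theorem sub_sum_mem_orthogonal_range {L : E →L[ℝ] W} {b : Basis ι ℝ E}
    (hb : Orthonormal ℝ (fun i ↦ L (b i))) (w : W) :
    w - ∑ i, ⟪L (b i), w⟫ • L (b i) ∈ (LinearMap.range L.toLinearMap)ᗮ := by
  classical
  rintro _ ⟨v, rfl⟩
  rw [← b.sum_repr v]
  simp only [map_sum, map_smul, sum_inner, inner_smul_left]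
  refine Finset.sum_eq_zero fun j _ ↦ ?_
  simp [inner_sub_right, inner_sum, inner_smul_right, orthonormal_iff_ite.1 hb]

theorem injective_of_orthonormal {L : E →L[ℝ] W} {b : Basis ι ℝ E}
    (hb : Orthonormal ℝ (fun i ↦ L (b i))) : Function.Injective L := by
  rw [injective_iff_map_eq_zero]
  intro v hv
  have h := hb.linearIndependent
  rw [Fintype.linearIndependent_iff] at h
  have h0 := h (fun i ↦ b.repr v i) (by
    have := hv
    rw [← b.sum_repr v, map_sum] at this
    simpa only [map_smul] using this)
  rw [← b.sum_repr v]
  simp [h0]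

variable [FiniteDimensional ℝ E] [FiniteDimensional ℝ W]

/-- The left inverse `(L† L)⁻¹ L†` of an injective map `L`, which vanishes on the orthogonal
complement of the range of `L`. It does not depend on the inner product of `E`, which serves only
to write down a formula that is visibly smooth in `L`. -/
noncomputable def orthogonalLeftInverse (L : E →L[ℝ] W) : W →L[ℝ] E :=
  Ring.inverse (L† ∘L L) ∘L L†

theorem isUnit_adjoint_comp_self {L : E →L[ℝ] W} (hL : Function.Injective L) :
    IsUnit (L† ∘L L) := by
  rw [ContinuousLinearMap.isUnit_iff_bijective]
  have hinj : Function.Injective (L† ∘L L) := by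
    rw [injective_iff_map_eq_zero]
    intro v hv
    have h : ⟪L v, L v⟫ = 0 := by
      rw [← adjoint_inner_right]
      change ⟪v, (L† ∘L L) v⟫ = 0
      rw [hv, inner_zero_right]
    exact hL (by rw [inner_self_eq_zero.1 h, map_zero])
  exact ⟨hinj, (LinearMap.injective_iff_surjective (f := (L† ∘L L).toLinearMap)).1 hinj⟩

theorem orthogonalLeftInverse_apply_apply {L : E →L[ℝ] W} (hL : Function.Injective L) (v : E) :
    orthogonalLeftInverse L (L v) = v :=
  DFunLike.congr_fun (Ring.inverse_mul_cancel _ (isUnit_adjoint_comp_self hL)) v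

theorem orthogonalLeftInverse_apply_of_mem_orthogonal {L : E →L[ℝ] W} {w : W}
    (hw : w ∈ (LinearMap.range L.toLinearMap)ᗮ) : orthogonalLeftInverse L w = 0 := by
  have h : (L†) w = 0 := by
    rw [ContinuousLinearMap.orthogonal_range] at hw
    exact hw
  simp [orthogonalLeftInverse, h]

theorem contDiff_adjoint : ContDiff ℝ ∞ (fun L : E →L[ℝ] W ↦ L†) :=
  IsBoundedLinearMap.contDiff
    { map_add := fun A B ↦ map_add _ A B
      map_smul := fun c A ↦ by simp
      bound := ⟨1, one_pos, fun A ↦ by simp⟩ }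

theorem contDiffAt_orthogonalLeftInverse {L : E →L[ℝ] W} (hL : Function.Injective L) :
    ContDiffAt ℝ ∞ (orthogonalLeftInverse : (E →L[ℝ] W) → W →L[ℝ] E) L := by
  have hadj : ContDiffAt ℝ ∞ (fun L : E →L[ℝ] W ↦ L†) L := contDiff_adjoint.contDiffAt
  have hcomp : ContDiffAt ℝ ∞ (fun L : E →L[ℝ] W ↦ L† ∘L L) L := hadj.clm_comp contDiffAt_id
  have hinv : ContDiffAt ℝ ∞ Ring.inverse (L† ∘L L) := by
    obtain ⟨u, hu⟩ := isUnit_adjoint_comp_self hL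
    rw [← hu]
    exact contDiffAt_ringInverse ℝ u
  have h : ContDiffAt ℝ ∞ (fun L : E →L[ℝ] W ↦ Ring.inverse (L† ∘L L)) L := 
    ContDiffAt.comp (g := Ring.inverse) L hinv hcomp
  exact h.clm_comp hadj

theorem orthogonalLeftInverse_eq_sum {L : E →L[ℝ] W} {b : Basis ι ℝ E}
    (hb : Orthonormal ℝ (fun i ↦ L (b i))) (w : W) :
    orthogonalLeftInverse L w = ∑ i, ⟪L (b i), w⟫ • b i := by
  have h := orthogonalLeftInverse_apply_of_mem_orthogonal (sub_sum_mem_orthogonal_range hb w)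
  rw [map_sub, sub_eq_zero] at h
  rw [h]
  simp [orthogonalLeftInverse_apply_apply (injective_of_orthonormal hb)]

/-- The trace of a bilinear map, formed with an orthonormal basis of `W` and pulled back by the left
inverse of `L`, is the trace formed with an orthonormal frame `L (b i)` of the range of `L`. -/
theorem sum_apply_orthogonalLeftInverse {L : E →L[ℝ] W} {b : Basis ι ℝ E}
    (hb : Orthonormal ℝ (fun i ↦ L (b i))) (w : OrthonormalBasis κ ℝ W)
    (B : E →L[ℝ] E →L[ℝ] V) (T : W →L[ℝ] E) :
    ∑ k, B (T (w k)) (orthogonalLeftInverse L (w k)) = ∑ i, B (T (L (b i))) (b i) := by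
  have h (i : ι) : B (T (L (b i))) (b i) = ∑ k, ⟪L (b i), w k⟫ • B (T (w k)) (b i) := by
    conv_lhs => rw [← w.sum_repr' (L (b i))]
    simp [real_inner_comm]
  simp only [orthogonalLeftInverse_eq_sum hb, map_sum, map_smul, h]
  exact Finset.sum_comm

end LeftInverse

/-! ### Higher derivatives -/

section Calculus

variable {E : Type*} [NormedAddCommGroup E] [NormedSpace ℝ E]
  {F : Type*} [NormedAddCommGroup F] [NormedSpace ℝ F] {φ : E → F} {y : E}

theorem contDiffAt_fderiv (hφ : ContDiffAt ℝ ∞ φ y) : ContDiffAt ℝ ∞ (fderiv ℝ φ) y :=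
  hφ.fderiv_right (by simp)

theorem two_le_infty : (2 : ℕ∞ω) ≤ ∞ :=
  WithTop.coe_le_coe.2 (le_top : (2 : ℕ∞) ≤ ⊤)

theorem fderiv_fderiv_symm (hφ : ContDiffAt ℝ ∞ φ y) (v w : E) :
    fderiv ℝ (fderiv ℝ φ) y v w = fderiv ℝ (fderiv ℝ φ) y w v :=
  (hφ.isSymmSndFDerivAt (by simpa using two_le_infty)).eq v w

theorem eventually_contDiffAt (hφ : ContDiffAt ℝ ∞ φ y) : ∀ᶠ z in 𝓝 y, ContDiffAt ℝ 2 φ z :=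
  (hφ.of_le two_le_infty).eventually (by simp)

/-- The third derivative is symmetric in its first two arguments, being a second derivative of `Dφ`,
and in its last two, being a derivative of the symmetric form `D²φ`. -/
theorem third_fderiv_cycle (hφ : ContDiffAt ℝ ∞ φ y) (u v : E) :
    fderiv ℝ (fderiv ℝ (fderiv ℝ φ)) y u v v = fderiv ℝ (fderiv ℝ (fderiv ℝ φ)) y v v u := by
  have h3 := (contDiffAt_fderiv (contDiffAt_fderiv hφ)).differentiableAt (by simp)
  rw [fderiv_fderiv_symm (contDiffAt_fderiv hφ) u v]
  have h (a b : E) : HasFDerivAt (fun z ↦ fderiv ℝ (fderiv ℝ φ) z a b)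
      (((fderiv ℝ (fderiv ℝ (fderiv ℝ φ)) y).flip a).flip b) y := by
    have := ((h3.hasFDerivAt.clm_apply (hasFDerivAt_const a y)).clm_apply (hasFDerivAt_const b y))
    convert this using 1
    ext; simp
  have heq : (fun z ↦ fderiv ℝ (fderiv ℝ φ) z u v) =ᶠ[𝓝 y]
      fun z ↦ fderiv ℝ (fderiv ℝ φ) z v u := by
    filter_upwards [eventually_contDiffAt hφ] with z hz
    exact (hz.isSymmSndFDerivAt (by simp)).eq u v
  exact DFunLike.congr_fun ((h u v).unique ((h v u).congr_of_eventuallyEq heq)) v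

variable {W : Type*} [NormedAddCommGroup W] [InnerProductSpace ℝ W] {φ : E → W}

/-- The first derivative of the relation `⟪Dφ(u), ξ⟫ = 0`, which says that `ξ` is normal. -/
theorem inner_fderiv_normal {ξ : E → W} (hφ : ContDiffAt ℝ ∞ φ y) (hξ : ContDiffAt ℝ ∞ ξ y)
    (h : ∀ᶠ z in 𝓝 y, ∀ u, ⟪fderiv ℝ φ z u, ξ z⟫ = 0) (a u : E) :
    ∀ᶠ z in 𝓝 y, ⟪fderiv ℝ φ z u, fderiv ℝ ξ z a⟫ + ⟪fderiv ℝ (fderiv ℝ φ) z a u, ξ z⟫ = 0 := by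
  filter_upwards [h.eventually_nhds, eventually_contDiffAt hφ, eventually_contDiffAt hξ]
    with z hz hφz hξz
  have hL := ((hφz.fderiv_right (m := 1) (by norm_num)).differentiableAt
    (by simp)).hasFDerivAt
  have h1 := (hL.clm_apply (hasFDerivAt_const u z)).inner ℝ
    (hξz.differentiableAt (by simp)).hasFDerivAt
  have h2 : (fun z ↦ ⟪fderiv ℝ φ z u, ξ z⟫) =ᶠ[𝓝 z] fun _ ↦ 0 := by
    filter_upwards [hz] with z' h' using h' u
  simpa using DFunLike.congr_fun (h1.unique ((hasFDerivAt_const 0 z).congr_of_eventuallyEq h2)) a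

/-- The second derivative of the relation `⟪Dφ(u), ξ⟫ = 0`. -/
theorem inner_fderiv_fderiv_normal {ξ : E → W} (hφ : ContDiffAt ℝ ∞ φ y)
    (hξ : ContDiffAt ℝ ∞ ξ y)
    (h : ∀ᶠ z in 𝓝 y, ∀ u, ⟪fderiv ℝ φ z u, ξ z⟫ = 0) (a u : E) :
    ⟪fderiv ℝ φ y u, fderiv ℝ (fderiv ℝ ξ) y a a⟫ =
      - ⟪fderiv ℝ (fderiv ℝ (fderiv ℝ φ)) y a a u, ξ y⟫
      - 2 * ⟪fderiv ℝ (fderiv ℝ φ) y a u, fderiv ℝ ξ y a⟫ := by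
  have hL := ((contDiffAt_fderiv hφ).differentiableAt (by simp)).hasFDerivAt
  have hH := ((contDiffAt_fderiv (contDiffAt_fderiv hφ)).differentiableAt (by simp)).hasFDerivAt
  have hX := (hξ.differentiableAt (by simp)).hasFDerivAt
  have hX' := ((contDiffAt_fderiv hξ).differentiableAt (by simp)).hasFDerivAt
  have h1 := ((hL.clm_apply (hasFDerivAt_const u y)).inner ℝ
    (hX'.clm_apply (hasFDerivAt_const a y))).add
    (((hH.clm_apply (hasFDerivAt_const a y)).clm_apply (hasFDerivAt_const u y)).inner ℝ hX)
  have h2 := DFunLike.congr_fun (h1.unique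
    ((hasFDerivAt_const 0 y).congr_of_eventuallyEq (inner_fderiv_normal hφ hξ h a u))) a
  simp at h2
  linarith

end Calculus

/-! ### The mean curvature of a parametrized submanifold -/

section Local

variable {E : Type*} [NormedAddCommGroup E] [InnerProductSpace ℝ E] [FiniteDimensional ℝ E]
  {W : Type*} [NormedAddCommGroup W] [InnerProductSpace ℝ W] [FiniteDimensional ℝ W]

/-- The trace of the second derivative of `φ` with respect to the metric induced by `φ`. It is the
sum of the values at a `φ`-orthonormal basis (`hessianTrace_eq_sum`), but is written with the left
inverse of `Dφ` and a fixed orthonormal basis of `W`, so as to be visibly smooth in `y`. -/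
noncomputable def hessianTrace (φ : E → W) (y : E) : W :=
  ∑ k, fderiv ℝ (fderiv ℝ φ) y (orthogonalLeftInverse (fderiv ℝ φ y) (stdOrthonormalBasis ℝ W k))
    (orthogonalLeftInverse (fderiv ℝ φ y) (stdOrthonormalBasis ℝ W k))

/-- The mean curvature vector of the immersion `φ`: the normal component of the trace of its
second derivative. -/
noncomputable def immersionMeanCurvature (φ : E → W) (y : E) : W :=
  hessianTrace φ y - fderiv ℝ φ y (orthogonalLeftInverse (fderiv ℝ φ y) (hessianTrace φ y))

variable {φ : E → W} {y : E}

theorem contDiffAt_leftInverse_fderiv (hφ : ContDiffAt ℝ ∞ φ y)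
    (hy : Function.Injective (fderiv ℝ φ y)) :
    ContDiffAt ℝ ∞ (fun z ↦ orthogonalLeftInverse (fderiv ℝ φ z)) y :=
  (contDiffAt_orthogonalLeftInverse hy).comp y (contDiffAt_fderiv hφ)

theorem contDiffAt_hessianTrace (hφ : ContDiffAt ℝ ∞ φ y)
    (hy : Function.Injective (fderiv ℝ φ y)) : ContDiffAt ℝ ∞ (hessianTrace φ) y := by
  refine ContDiffAt.sum fun k _ ↦ ?_
  have h := (contDiffAt_leftInverse_fderiv hφ hy).clm_apply
    (contDiffAt_const (c := stdOrthonormalBasis ℝ W k))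
  exact ((contDiffAt_fderiv (contDiffAt_fderiv hφ)).clm_apply h).clm_apply h

theorem contDiffAt_immersionMeanCurvature (hφ : ContDiffAt ℝ ∞ φ y)
    (hy : Function.Injective (fderiv ℝ φ y)) : ContDiffAt ℝ ∞ (immersionMeanCurvature φ) y :=
  (contDiffAt_hessianTrace hφ hy).sub ((contDiffAt_fderiv hφ).clm_apply
    ((contDiffAt_leftInverse_fderiv hφ hy).clm_apply (contDiffAt_hessianTrace hφ hy)))

variable {ι : Type*} [Fintype ι] {b : Basis ι ℝ E}

theorem hessianTrace_eq_sum (hb : Orthonormal ℝ (fun i ↦ fderiv ℝ φ y (b i))) :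
    hessianTrace φ y = ∑ i, fderiv ℝ (fderiv ℝ φ) y (b i) (b i) := by
  have h := sum_apply_orthogonalLeftInverse hb (stdOrthonormalBasis ℝ W)
    (fderiv ℝ (fderiv ℝ φ) y) (orthogonalLeftInverse (fderiv ℝ φ y))
  simp only [orthogonalLeftInverse_apply_apply (injective_of_orthonormal hb)] at h
  exact h

theorem fderiv_hessianTrace (hφ : ContDiffAt ℝ ∞ φ y)
    (hb : Orthonormal ℝ (fun i ↦ fderiv ℝ φ y (b i))) (a : E) :
    fderiv ℝ (hessianTrace φ) y a = ∑ i, fderiv ℝ (fderiv ℝ (fderiv ℝ φ)) y a (b i) (b i)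
      - (2 : ℝ) • ∑ i, ∑ j, ⟪fderiv ℝ φ y (b j), fderiv ℝ (fderiv ℝ φ) y a (b i)⟫ •
        fderiv ℝ (fderiv ℝ φ) y (b j) (b i) := by
  have hy := injective_of_orthonormal hb
  have hl := orthogonalLeftInverse_apply_apply hy
  have hs := orthogonalLeftInverse_eq_sum hb
  set P := fun z ↦ orthogonalLeftInverse (fderiv ℝ φ z)
  set L := fderiv ℝ φ
  set H := fderiv ℝ L
  have hP := ((contDiffAt_leftInverse_fderiv hφ hy).differentiableAt (by simp)).hasFDerivAt
  have hL := ((contDiffAt_fderiv hφ).differentiableAt (by simp)).hasFDerivAt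
  have hH := ((contDiffAt_fderiv (contDiffAt_fderiv hφ)).differentiableAt (by simp)).hasFDerivAt
  have hinj : ∀ᶠ z in 𝓝 y, Function.Injective (L z) :=
    hL.continuousAt.eventually (ContinuousLinearMap.isOpen_injective.mem_nhds hy)
  -- The derivative of the left inverse is found by differentiating `P ∘ L = 1`.
  have hPL (v : E) : fderiv ℝ P y a (L y v) = - P y (H y a v) := by
    have h1 := hP.clm_apply (hL.clm_apply (hasFDerivAt_const v y))
    have h2 : (fun z ↦ P z (L z v)) =ᶠ[𝓝 y] fun _ ↦ v := by
      filter_upwards [hinj] with z hz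
      exact orthogonalLeftInverse_apply_apply hz v
    have h3 := DFunLike.congr_fun (h1.unique ((hasFDerivAt_const v y).congr_of_eventuallyEq h2)) a
    simp at h3
    exact eq_neg_of_add_eq_zero_right h3
  have hder : fderiv ℝ (hessianTrace φ) y a = ∑ k,
      (fderiv ℝ H y a (P y (stdOrthonormalBasis ℝ W k)) (P y (stdOrthonormalBasis ℝ W k))
      + (2 : ℝ) • H y (fderiv ℝ P y a (stdOrthonormalBasis ℝ W k))
        (P y (stdOrthonormalBasis ℝ W k))) := by
    have h := HasFDerivAt.sum (u := Finset.univ) fun k _ ↦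
      (hH.clm_apply (hP.clm_apply (hasFDerivAt_const (stdOrthonormalBasis ℝ W k) y))).clm_apply
        (hP.clm_apply (hasFDerivAt_const (stdOrthonormalBasis ℝ W k) y))
    have h' := h.fderiv
    have h'' : (hessianTrace φ) = ∑ k, fun z ↦ H z (P z (stdOrthonormalBasis ℝ W k))
      (P z (stdOrthonormalBasis ℝ W k)) := by
      ext z; simp [hessianTrace, P, H, L]
    rw [h'', h']
    simp only [sum_apply]
    refine Finset.sum_congr rfl fun k _ ↦ ?_
    simp
    rw [fderiv_fderiv_symm hφ (P y _) _]
    module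
  rw [hder, Finset.sum_add_distrib, ← Finset.smul_sum]
  have t1 := sum_apply_orthogonalLeftInverse hb (stdOrthonormalBasis ℝ W) (fderiv ℝ H y a) (P y)
  have t2 := sum_apply_orthogonalLeftInverse hb (stdOrthonormalBasis ℝ W) (H y) (fderiv ℝ P y a)
  simp only [L, H, P] at t1 t2 hPL hl hs ⊢
  rw [t1, t2]
  simp only [hPL, map_neg, neg_apply, Finset.sum_neg_distrib, smul_neg, sub_eq_add_neg]
  simp_rw [hl, hs, map_sum, map_smul,
    sum_apply, smul_apply]

/-- The normal derivative of the mean curvature vector. The derivative of the tangential component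
`Dφ(P(q))` of `q = hessianTrace φ` contributes the last sum only, as `s` is normal to `Dφ`. -/
theorem inner_fderiv_immersionMeanCurvature (hφ : ContDiffAt ℝ ∞ φ y)
    (hb : Orthonormal ℝ (fun i ↦ fderiv ℝ φ y (b i))) (a : E) {s : W}
    (hs : ∀ u, ⟪fderiv ℝ φ y u, s⟫ = 0) :
    ⟪fderiv ℝ (immersionMeanCurvature φ) y a, s⟫ =
      ∑ i, ⟪fderiv ℝ (fderiv ℝ (fderiv ℝ φ)) y a (b i) (b i), s⟫
      - 2 * ∑ i, ∑ j, ⟪fderiv ℝ φ y (b j), fderiv ℝ (fderiv ℝ φ) y a (b i)⟫ *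
        ⟪fderiv ℝ (fderiv ℝ φ) y (b j) (b i), s⟫
      - ∑ i, ∑ j, ⟪fderiv ℝ φ y (b j), fderiv ℝ (fderiv ℝ φ) y (b i) (b i)⟫ *
        ⟪fderiv ℝ (fderiv ℝ φ) y a (b j), s⟫ := by
  have hy := injective_of_orthonormal hb
  have hP := ((contDiffAt_leftInverse_fderiv hφ hy).differentiableAt (by simp)).hasFDerivAt
  have hL := ((contDiffAt_fderiv hφ).differentiableAt (by simp)).hasFDerivAt
  have hQ := ((contDiffAt_hessianTrace hφ hy).differentiableAt (by simp)).hasFDerivAt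
  have h : fderiv ℝ (immersionMeanCurvature φ) y = _ :=
    (hQ.sub (hL.clm_apply (hP.clm_apply hQ))).fderiv
  rw [h]
  simp only [sub_apply, add_apply, inner_sub_left, inner_add_left, coe_comp, Function.comp_apply,
    flip_apply, hs, zero_add, orthogonalLeftInverse_eq_sum hb]
  rw [fderiv_hessianTrace hφ hb, hessianTrace_eq_sum hb,
    Finset.sum_comm (f := fun i j ↦ ⟪fderiv ℝ φ y (b j),
      fderiv ℝ (fderiv ℝ φ) y (b i) (b i)⟫ * _)]
  simp_rw [inner_sub_left, inner_sum, map_sum, map_smul, sum_inner, Finset.sum_smul,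
    inner_smul_left, sum_inner, inner_smul_left]
  simp

/-- Let `ξ` be a normal field along `φ` whose derivative at `y` is tangential. Then the tangential
part of the Laplacian of `ξ` is given by the normal derivative of the mean curvature vector, paired
with `ξ`. The sum over `j` is the Christoffel symbol `Γ(b i, b i)` of the metric induced by `φ`. -/
theorem inner_laplacian_normal {ξ : E → W} (hφ : ContDiffAt ℝ ∞ φ y) (hξ : ContDiffAt ℝ ∞ ξ y)
    (h : ∀ᶠ z in 𝓝 y, ∀ u, ⟪fderiv ℝ φ z u, ξ z⟫ = 0)
    (hb : Orthonormal ℝ (fun i ↦ fderiv ℝ φ y (b i)))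
    (htan : ∀ a, fderiv ℝ ξ y a ∈ LinearMap.range (fderiv ℝ φ y).toLinearMap) (a : E) :
    ⟪fderiv ℝ φ y a, ∑ i, (fderiv ℝ (fderiv ℝ ξ) y (b i) (b i) - fderiv ℝ ξ y
      (∑ j, ⟪fderiv ℝ φ y (b j), fderiv ℝ (fderiv ℝ φ) y (b i) (b i)⟫ • b j))⟫ =
      - ⟪fderiv ℝ (immersionMeanCurvature φ) y a, ξ y⟫ := by
  -- By the first derivative of normality, `Dξ` is the negative of the shape operator.
  have hexp (v : E) : fderiv ℝ ξ y v =
      - ∑ j, ⟪fderiv ℝ (fderiv ℝ φ) y v (b j), ξ y⟫ • fderiv ℝ φ y (b j) := by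
    have hr : (∑ j, ⟪fderiv ℝ φ y (b j), fderiv ℝ ξ y v⟫ • fderiv ℝ φ y (b j)) ∈
        LinearMap.range (fderiv ℝ φ y).toLinearMap :=
      Submodule.sum_mem _ fun j _ ↦ Submodule.smul_mem _ _ ⟨b j, rfl⟩
    have h0 := Submodule.disjoint_def.1 (Submodule.orthogonal_disjoint _) _
      (Submodule.sub_mem _ (htan v) hr) (sub_sum_mem_orthogonal_range hb (fderiv ℝ ξ y v))
    rw [sub_eq_zero.1 h0, ← Finset.sum_neg_distrib]
    refine Finset.sum_congr rfl fun j _ ↦ ?_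
    rw [← neg_smul, eq_neg_of_add_eq_zero_left (inner_fderiv_normal hφ hξ h v (b j)).self_of_nhds]
  rw [inner_fderiv_immersionMeanCurvature hφ hb a h.self_of_nhds]
  have h1 (u v : E) : ⟪fderiv ℝ φ y u, fderiv ℝ ξ y v⟫ = - ⟪fderiv ℝ (fderiv ℝ φ) y v u, ξ y⟫ :=
    eq_neg_of_add_eq_zero_left (inner_fderiv_normal hφ hξ h v u).self_of_nhds
  have h2 (i : ι) : ⟪fderiv ℝ (fderiv ℝ φ) y (b i) a, fderiv ℝ ξ y (b i)⟫ =
      - ∑ j, ⟪fderiv ℝ φ y (b j), fderiv ℝ (fderiv ℝ φ) y a (b i)⟫ *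
        ⟪fderiv ℝ (fderiv ℝ φ) y (b j) (b i), ξ y⟫ := by
    rw [hexp, inner_neg_right, inner_sum, fderiv_fderiv_symm hφ (b i) a]
    simp only [inner_smul_right, fderiv_fderiv_symm hφ (b i), real_inner_comm, mul_comm]
  have h3 (i : ι) : ⟪fderiv ℝ φ y a, fderiv ℝ ξ y
      (∑ j, ⟪fderiv ℝ φ y (b j), fderiv ℝ (fderiv ℝ φ) y (b i) (b i)⟫ • b j)⟫ =
      - ∑ j, ⟪fderiv ℝ φ y (b j), fderiv ℝ (fderiv ℝ φ) y (b i) (b i)⟫ *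
        ⟪fderiv ℝ (fderiv ℝ φ) y a (b j), ξ y⟫ := by
    simp_rw [map_sum, map_smul, inner_sum, inner_smul_right, h1, fderiv_fderiv_symm hφ a]
    simp
  simp only [inner_sum, inner_sub_right, inner_fderiv_fderiv_normal hφ hξ h, h2, h3,
    third_fderiv_cycle hφ a]
  simp only [Finset.sum_sub_distrib, Finset.sum_neg_distrib, ← Finset.mul_sum]
  ring

end Local

end Riemannian

/-! ### The Christoffel symbols of the Grassmannian -/

namespace Gr

open Module ContinuousLinearMap Riemannian
open scoped InnerProduct

variable {p N : ℕ}

theorem innerHS_eq_trace (A B : Model p N) :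
    innerHS A B = LinearMap.trace ℝ _ (A† ∘L B).toLinearMap := by
  rw [innerHS_apply, LinearMap.trace_eq_sum_inner _ (EuclideanSpace.basisFun (Fin p) ℝ)]
  simp [adjoint_inner_right]

theorem innerHS_comp_comp (A B : Model p N)
    (C : EuclideanSpace ℝ (Fin (N - p)) →L[ℝ] EuclideanSpace ℝ (Fin (N - p)))
    (H : EuclideanSpace ℝ (Fin p) →L[ℝ] EuclideanSpace ℝ (Fin p)) :
    innerHS (C ∘L A ∘L H) (C ∘L B ∘L H) =
      LinearMap.trace ℝ _ (A† ∘L (C† ∘L C) ∘L B ∘L (H ∘L H†)).toLinearMap := by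
  rw [innerHS_eq_trace]
  have h := LinearMap.trace_comp_comm' (H†).toLinearMap (A† ∘L (C† ∘L C) ∘L B ∘L H).toLinearMap
  have h1 : ((C ∘L A ∘L H)† ∘L (C ∘L B ∘L H)).toLinearMap =
      (H†).toLinearMap ∘ₗ (A† ∘L (C† ∘L C) ∘L B ∘L H).toLinearMap := by
    ext1 v
    simp [adjoint_comp]
  rw [h1, ← h]
  rfl

/-- The product rule at a zero of the first factor. -/
theorem _root_.HasFDerivAt.clm_comp_of_eq_zero {X E F G : Type*} [NormedAddCommGroup X]
    [NormedSpace ℝ X] [NormedAddCommGroup E] [NormedSpace ℝ E] [NormedAddCommGroup F]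
    [NormedSpace ℝ F] [NormedAddCommGroup G] [NormedSpace ℝ G] {u : X → F →L[ℝ] G}
    {z : X → E →L[ℝ] F} {u' : X →L[ℝ] F →L[ℝ] G} {x : X} (hu : HasFDerivAt u u' x)
    (hz : DifferentiableAt ℝ z x) (h0 : u x = 0) :
    ∃ D : X →L[ℝ] E →L[ℝ] G, HasFDerivAt (fun x ↦ u x ∘L z x) D x ∧ ∀ v, D v = u' v ∘L z x := by
  refine ⟨_, hu.clm_comp hz.hasFDerivAt, fun v ↦ ?_⟩
  ext w
  change u x (fderiv ℝ z x v w) + u' v (z x w) = u' v (z x w)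
  rw [h0, zero_apply, zero_add]

theorem adjoint_coframe_self_graph (S : Gr p N) (Y : Model p N) :
    (coframe (graph S Y))† ∘L graphMap S Y = 0 := by
  obtain ⟨g, hg⟩ := exists_graphMap_eq S Y
  rw [hg, ← comp_assoc, adjoint_coframe_frame, zero_comp]

/-- The derivative at `Y` of the change of graph charts from the chart at `S` to the chart at the
graph of `Y`. The first factor of `slope_graph` vanishes there, so only its derivative
contributes. -/
theorem hasFDerivAt_slope_graph (S : Gr p N) (Y : Model p N) :
    ∃ D : Model p N →L[ℝ] Model p N, HasFDerivAt (fun A ↦ slope (graph S Y) (graph S A)) D Y ∧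
      ∀ A, D A = ((coframe (graph S Y))† ∘L coframe S) ∘L A ∘L
        Ring.inverse ((frame (graph S Y))† ∘L graphMap S Y) := by
  set T := graph S Y
  have hZ : DifferentiableAt ℝ (fun A ↦ Ring.inverse ((frame T)† ∘L graphMap S A)) Y := by
    have hu : IsUnit ((frame T)† ∘L graphMap S Y) := by
      rw [← isUnit_projS_graph, projS, adjoint_frame_frame]
      exact isUnit_one
    obtain ⟨u, hu⟩ := hu
    have h1 : DifferentiableAt ℝ Ring.inverse ((frame T)† ∘L graphMap S Y) := by
      rw [← hu]
      exact (contDiffAt_ringInverse ℝ u (n := 1)).differentiableAt (by simp)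
    have h2 : DifferentiableAt ℝ (fun A ↦ (frame T)† ∘L graphMap S A) Y :=
      (contDiff_const.clm_comp (contDiff_graphMap S)).differentiable (by simp) Y
    exact DifferentiableAt.comp (g := Ring.inverse) Y h1 h2
  have hg : HasFDerivAt (graphMap S) (compL ℝ _ _ _ (coframe S)) Y :=
    ((compL ℝ _ _ _ (coframe S) : Model p N →L[ℝ] _).hasFDerivAt (x := Y)).const_add (frame S)
  have hU : HasFDerivAt (fun A ↦ (coframe T)† ∘L graphMap S A)
      (compL ℝ _ _ _ ((coframe T)†) ∘L compL ℝ _ _ _ (coframe S)) Y :=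
    HasFDerivAt.comp (g := fun Z ↦ (coframe T)† ∘L Z) Y
      (compL ℝ _ _ _ ((coframe T)†)).hasFDerivAt hg
  simp only [slope_graph]
  exact hU.clm_comp_of_eq_zero hZ (adjoint_coframe_self_graph S Y)

theorem extChartAt_target (S : Gr p N) : (extChartAt 𝓘(ℝ, Model p N) S).target = Set.univ := by
  rw [_root_.extChartAt_target]
  simp only [modelWithCornersSelf_coe_symm, Set.preimage_id, modelWithCornersSelf_coe, Set.range_id,
    Set.inter_univ]
  rfl

/-- The metric in the graph chart at `S` is `tr(A† (1 - Y K Y†) B K)` with `K = (1 + Y† Y)⁻¹`. -/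
theorem metricCoeff_eq (S : Gr p N) (A B Y : Model p N) :
    metricCoeff (E := Model p N) S A B Y = LinearMap.trace ℝ _
      (A† ∘L (1 - Y ∘L Ring.inverse (1 + Y† ∘L Y) ∘L Y†) ∘L B ∘L
        Ring.inverse (1 + Y† ∘L Y)).toLinearMap := by
  set T := graph S Y
  set G := (frame T)† ∘L graphMap S Y with hG
  set H := Ring.inverse G
  set C := (coframe T)† ∘L coframe S with hC
  have hmf (A : Model p N) : mfderiv 𝓘(ℝ, Model p N) 𝓘(ℝ, Model p N)
      (extChartAt 𝓘(ℝ, Model p N) S).symm Y A = C ∘L A ∘L H := by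
    obtain ⟨D, hD, hD'⟩ := hasFDerivAt_slope_graph S Y
    have hd : MDifferentiableAt 𝓘(ℝ, Model p N) 𝓘(ℝ, Model p N)
        (extChartAt 𝓘(ℝ, Model p N) S).symm Y :=
      ((contMDiffOn_extChartAt_symm (n := ∞) S).contMDiffAt ((isOpen_extChartAt_target S).mem_nhds
        (by rw [extChartAt_target]; trivial))).mdifferentiableAt (by simp)
    have : fderivWithin ℝ (writtenInExtChartAt 𝓘(ℝ, Model p N) 𝓘(ℝ, Model p N) Y
      (extChartAt 𝓘(ℝ, Model p N) S).symm) (Set.range 𝓘(ℝ, Model p N))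
      (extChartAt 𝓘(ℝ, Model p N) Y Y) = D := by
      simp only [modelWithCornersSelf_coe, Set.range_id, fderivWithin_univ]
      exact hD.fderiv
    exact (DFunLike.congr_fun (hd.mfderiv.trans this) A).trans (hD' A)
  have h0 : metricCoeff (E := Model p N) S A B Y = innerHS (C ∘L A ∘L H) (C ∘L B ∘L H) := by
    rw [← hmf, ← hmf]
    rfl
  have hGu : IsUnit G := by
    rw [hG, ← isUnit_projS_graph, projS, adjoint_frame_frame]
    exact isUnit_one
  have hFG : frame T ∘L G = graphMap S Y := by
    ext1 v
    exact frame_adjoint_apply T ⟨v, rfl⟩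
  have hGG : G† ∘L G = 1 + Y† ∘L Y := by
    have h1 : G† ∘L G = (graphMap S Y)† ∘L graphMap S Y := by
      rw [← hFG, adjoint_comp (frame T) G, comp_assoc (G†), ← comp_assoc ((frame T)†),
        adjoint_frame_frame]
      rfl
    rw [h1, graphMap, map_add, adjoint_comp, add_comp, comp_add, comp_add, adjoint_frame_frame,
      ← comp_assoc, adjoint_frame_coframe, comp_assoc _ _ (frame S), adjoint_coframe_frame,
      comp_assoc, ← comp_assoc _ _ Y, adjoint_coframe_coframe, zero_comp, comp_zero, add_zero,
      zero_add]
    rfl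
  -- As `G† G = 1 + Y† Y`, the product `H H†` is the inverse of `1 + Y† Y`, whereas `G` and `H`
  -- depend on the chosen frame of the graph.
  have hGH : G * H = 1 := Ring.mul_inverse_cancel _ hGu
  have hHG : H * G = 1 := Ring.inverse_mul_cancel _ hGu
  have hHH : H ∘L H† = Ring.inverse (1 + Y† ∘L Y) := by
    rw [← hGG]
    change H * star H = Ring.inverse (star G * G)
    have h1 : H * star H * (star G * G) = 1 := by
      rw [mul_assoc, ← mul_assoc (star H), ← star_mul, hGH, star_one, one_mul, hHG]
    have h2 : star G * G * (H * star H) = 1 := by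
      rw [mul_assoc, ← mul_assoc G, hGH, one_mul, ← star_mul, hHG, star_one]
    exact (Ring.inverse_unit ⟨_, _, h2, h1⟩).symm
  have hYH : (coframe S)† ∘L frame T = Y ∘L H := by
    have h1 : frame T = graphMap S Y ∘L H := by
      rw [← hFG, comp_assoc]
      change _ = frame T ∘L (G * H)
      rw [hGH]
      rfl
    rw [h1, ← comp_assoc, adjoint_coframe_graphMap]
  have hCC : C† ∘L C = 1 - Y ∘L Ring.inverse (1 + Y† ∘L Y) ∘L Y† := by
    have h2 : coframe T ∘L (coframe T)† = 1 - frame T ∘L (frame T)† :=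
      eq_sub_of_add_eq' (frame_add_coframe T)
    have h3 : Y ∘L (H ∘L H†) ∘L Y† = (Y ∘L H) ∘L (Y ∘L H)† := by
      rw [adjoint_comp]; rfl
    rw [← hHH, h3, ← hYH, hC, adjoint_comp, adjoint_adjoint, adjoint_comp, adjoint_adjoint,
      comp_assoc, ← comp_assoc _ _ (coframe S), h2, sub_comp, comp_sub]
    congr 1
    exact adjoint_coframe_coframe S
  rw [h0, innerHS_comp_comp, hHH, hCC]

theorem metricCoeff_neg (S : Gr p N) (A B Y : Model p N) :
    metricCoeff (E := Model p N) S A B (-Y) = metricCoeff (E := Model p N) S A B Y := by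
  simp [metricCoeff_eq]

theorem extChartAt_self (S : Gr p N) : extChartAt 𝓘(ℝ, Model p N) S S = 0 := by
  change slope S S = 0
  rw [slope, adjoint_coframe_frame, zero_comp]

/-- The metric coefficients of the graph chart at `S` are even functions, so that their derivatives
vanish at `S`. -/
theorem christoffel_eq_zero (S : Gr p N) (A B : Model p N) :
    christoffel (E := Model p N) S A B = 0 := by
  have h (A B D : Model p N) : metricCoeffDeriv (E := Model p N) S A B D = 0 := by
    rw [metricCoeffDeriv, extChartAt_self]
    by_cases hd : DifferentiableAt ℝ (metricCoeff (E := Model p N) S B D) 0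
    · have h1 := hd.hasFDerivAt
      have h2 : HasFDerivAt (fun Y ↦ metricCoeff (E := Model p N) S B D (-Y)) _ 0 :=
        HasFDerivAt.comp (g := metricCoeff (E := Model p N) S B D) (0 : Model p N) (f := fun Y ↦ -Y)
          (by simpa using h1) (hasFDerivAt_id (0 : Model p N)).neg
      simp only [metricCoeff_neg] at h2
      have h3 := DFunLike.congr_fun (h1.unique h2) A
      simp at h3
      linarith
    · rw [fderiv_zero_of_not_differentiableAt hd]
      rfl
  have h' (D : Model p N) : ((metricCoeffDeriv (E := Model p N) S A B D +
      metricCoeffDeriv (E := Model p N) S B A D - metricCoeffDeriv (E := Model p N) S D A B) / 2) •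
      D = 0 := by
    rw [h, h, h, add_zero, sub_zero, zero_div]
    exact zero_smul ℝ D
  exact Finset.sum_eq_zero fun k _ ↦ h' _

end Gr

/-! ### Isometric immersions in local coordinates -/

namespace Riemannian

open scoped InnerProduct
open ContinuousLinearMap Filter Topology Module

section Composition

variable {E F G : Type*} [NormedAddCommGroup E] [NormedSpace ℝ E] [NormedAddCommGroup F]
  [NormedSpace ℝ F] [NormedAddCommGroup G] [NormedSpace ℝ G]

theorem fderiv_fderiv_comp {g : F → G} {f : E → F} {y : E} (hg : ContDiffAt ℝ ∞ g (f y))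
    (hf : ContDiffAt ℝ ∞ f y) (v w : E) :
    fderiv ℝ (fderiv ℝ (g ∘ f)) y v w =
      fderiv ℝ (fderiv ℝ g) (f y) (fderiv ℝ f y v) (fderiv ℝ f y w) +
        fderiv ℝ g (f y) (fderiv ℝ (fderiv ℝ f) y v w) := by
  have heq : fderiv ℝ (g ∘ f) =ᶠ[𝓝 y] fun z ↦ (fderiv ℝ g (f z)).comp (fderiv ℝ f z) := by
    filter_upwards [hf.continuousAt.eventually (eventually_contDiffAt hg), eventually_contDiffAt hf]
      with z hgz hfz
    exact fderiv_comp z (hgz.differentiableAt (by simp)) (hfz.differentiableAt (by simp))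
  have h1 := ((contDiffAt_fderiv hg).differentiableAt (by simp)).hasFDerivAt.comp y
    (hf.differentiableAt (by simp)).hasFDerivAt
  have h2 := ((contDiffAt_fderiv hf).differentiableAt (by simp)).hasFDerivAt
  have h3 : fderiv ℝ (fun z ↦ (fderiv ℝ g (f z)).comp (fderiv ℝ f z)) y = _ :=
    (h1.clm_comp h2).fderiv
  rw [heq.fderiv_eq, h3]
  simp [add_comm]

end Composition

section LocalExpr

variable {E : Type*} [NormedAddCommGroup E] [NormedSpace ℝ E]
  {W : Type*} [NormedAddCommGroup W] [NormedSpace ℝ W]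
variable {M : Type*} [TopologicalSpace M] [ChartedSpace E M]

/-- The local expression of a map on `M` in the preferred chart at `x`. -/
noncomputable def localExpr {α : Type*} (f : M → α) (x : M) : E → α :=
  f ∘ (extChartAt 𝓘(ℝ, E) x).symm

theorem extChartAt_target_mem_nhds_self (x : M) {y : E} (hy : y ∈ (extChartAt 𝓘(ℝ, E) x).target) :
    (extChartAt 𝓘(ℝ, E) x).target ∈ 𝓝 y :=
  (isOpen_extChartAt_target x).mem_nhds hy

theorem localExpr_eventuallyEq {α : Type*} (f : M → α) {x x' : M}
    (hx : x' ∈ (extChartAt 𝓘(ℝ, E) x).source) :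
    localExpr (E := E) f x' =ᶠ[𝓝 (extChartAt 𝓘(ℝ, E) x' x')]
      localExpr f x ∘ (extChartAt 𝓘(ℝ, E) x ∘ (extChartAt 𝓘(ℝ, E) x').symm) := by
  have h := (continuousAt_extChartAt_symm (I := 𝓘(ℝ, E)) x').eventually
    (by rw [extChartAt_to_inv]; exact (isOpen_extChartAt_source x).mem_nhds hx)
  filter_upwards [h] with z hz
  simp only [localExpr, Function.comp_apply]
  rw [PartialEquiv.left_inv _ hz]

theorem mfderiv_eq_fderiv_localExpr {f : M → W} {x : M}
    (hf : MDifferentiableAt 𝓘(ℝ, E) 𝓘(ℝ, W) f x) (v : E) :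
    mfderiv 𝓘(ℝ, E) 𝓘(ℝ, W) f x v = fderiv ℝ (localExpr f x) (extChartAt 𝓘(ℝ, E) x x) v := by
  have h := hf.mfderiv
  have h2 : fderivWithin ℝ (writtenInExtChartAt 𝓘(ℝ, E) 𝓘(ℝ, W) x f) (Set.range 𝓘(ℝ, E))
      (extChartAt 𝓘(ℝ, E) x x) = fderiv ℝ (localExpr f x) (extChartAt 𝓘(ℝ, E) x x) := by
    simp only [modelWithCornersSelf_coe, Set.range_id, fderivWithin_univ]
    rfl
  exact DFunLike.congr_fun (h.trans h2) v

variable [IsManifold 𝓘(ℝ, E) ∞ M]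

theorem contMDiffAt_extChartAt_symm {x : M} {y : E} (hy : y ∈ (extChartAt 𝓘(ℝ, E) x).target) :
    ContMDiffAt 𝓘(ℝ, E) 𝓘(ℝ, E) ∞ (extChartAt 𝓘(ℝ, E) x).symm y :=
  (contMDiffOn_extChartAt_symm x).contMDiffAt (extChartAt_target_mem_nhds_self x hy)

theorem contDiffAt_localExpr {f : M → W} (hf : ContMDiff 𝓘(ℝ, E) 𝓘(ℝ, W) ∞ f) {x : M} {y : E}
    (hy : y ∈ (extChartAt 𝓘(ℝ, E) x).target) : ContDiffAt ℝ ∞ (localExpr f x) y :=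
  contMDiffAt_iff_contDiffAt.1 (hf.contMDiffAt.comp y (contMDiffAt_extChartAt_symm hy))

theorem contDiffAt_chartChange {x x' : M} (hx : x' ∈ (extChartAt 𝓘(ℝ, E) x).source) :
    ContDiffAt ℝ ∞ (extChartAt 𝓘(ℝ, E) x ∘ (extChartAt 𝓘(ℝ, E) x').symm)
      (extChartAt 𝓘(ℝ, E) x' x') := by
  refine contMDiffAt_iff_contDiffAt.1 (ContMDiffAt.comp (I' := 𝓘(ℝ, E)) _ ?_
    (contMDiffAt_extChartAt_symm (mem_extChartAt_target x')))
  rw [extChartAt_to_inv]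
  exact contMDiffAt_extChartAt' (by rwa [extChartAt_source] at hx)

end LocalExpr

section Immersion

variable {E : Type*} [NormedAddCommGroup E] [InnerProductSpace ℝ E]
  {W : Type*} [NormedAddCommGroup W] [InnerProductSpace ℝ W]
  {M : Type*} [TopologicalSpace M] [ChartedSpace E M]
  [Bundle.RiemannianBundle (fun x : M ↦ TangentSpace 𝓘(ℝ, E) x)] {I : M → W}

theorem IsIsometricImmersion.differential_eq (hI : IsIsometricImmersion (E := E) I) (x : M)
    (v : E) :
    differential (E := E) I x v = fderiv ℝ (localExpr I x) (extChartAt 𝓘(ℝ, E) x x) v :=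
  mfderiv_eq_fderiv_localExpr ((hI.contMDiff x).mdifferentiableAt (by simp)) v

/-- The orthonormal basis of the tangent space at `x`, as a basis of the model space. -/
noncomputable def tangentBasis [FiniteDimensional ℝ E] (x : M) :
    Basis (Fin (finrank ℝ (TangentSpace 𝓘(ℝ, E) x))) ℝ E :=
  (stdOrthonormalBasis ℝ (TangentSpace 𝓘(ℝ, E) x)).toBasis

theorem tangentBasis_apply [FiniteDimensional ℝ E] (x : M) (i) :
    tangentBasis (E := E) x i = stdOrthonormalBasis ℝ (TangentSpace 𝓘(ℝ, E) x) i :=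
  congrFun (stdOrthonormalBasis ℝ (TangentSpace 𝓘(ℝ, E) x)).coe_toBasis i

theorem IsIsometricImmersion.orthonormal [FiniteDimensional ℝ E]
    (hI : IsIsometricImmersion (E := E) I) (x : M) :
    Orthonormal ℝ fun i ↦
      fderiv ℝ (localExpr I x) (extChartAt 𝓘(ℝ, E) x x) (tangentBasis x i) := by
  classical
  rw [orthonormal_iff_ite]
  intro i j
  rw [← hI.differential_eq, ← hI.differential_eq, tangentBasis_apply, tangentBasis_apply]
  rw [hI.inner_eq]
  exact orthonormal_iff_ite.1 (stdOrthonormalBasis ℝ (TangentSpace 𝓘(ℝ, E) x)).orthonormal i j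

variable [IsManifold 𝓘(ℝ, E) ∞ M]

theorem IsIsometricImmersion.metricCoeff_eq (hI : IsIsometricImmersion (E := E) I) (x : M)
    (v w : E) {y : E} (hy : y ∈ (extChartAt 𝓘(ℝ, E) x).target) :
    metricCoeff x v w y = ⟪fderiv ℝ (localExpr I x) y v, fderiv ℝ (localExpr I x) y w⟫ := by
  have h (v : E) : fderiv ℝ (localExpr I x) y v = differential (E := E) I
      ((extChartAt 𝓘(ℝ, E) x).symm y)
      (mfderiv 𝓘(ℝ, E) 𝓘(ℝ, E) (extChartAt 𝓘(ℝ, E) x).symm y v) := by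
    have h1 := mfderiv_comp y ((hI.contMDiff _).mdifferentiableAt (by simp))
      ((contMDiffAt_extChartAt_symm hy).mdifferentiableAt (by simp))
    rw [localExpr, ← mfderiv_eq_fderiv, h1]
    rfl
  rw [metricCoeff, h, h, hI.inner_eq]

theorem IsIsometricImmersion.fderiv_comp_chartChange (hI : IsIsometricImmersion (E := E) I)
    {x x' : M} (hx : x' ∈ (extChartAt 𝓘(ℝ, E) x).source) (v : E) :
    fderiv ℝ (localExpr I x') (extChartAt 𝓘(ℝ, E) x' x') v =
      fderiv ℝ (localExpr I x) (extChartAt 𝓘(ℝ, E) x x')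
        (fderiv ℝ (extChartAt 𝓘(ℝ, E) x ∘ (extChartAt 𝓘(ℝ, E) x').symm)
          (extChartAt 𝓘(ℝ, E) x' x') v) := by
  have hφ := contDiffAt_localExpr hI.contMDiff (PartialEquiv.map_source _ hx)
  have h0 : (extChartAt 𝓘(ℝ, E) x ∘ (extChartAt 𝓘(ℝ, E) x').symm) (extChartAt 𝓘(ℝ, E) x' x') =
    extChartAt 𝓘(ℝ, E) x x' := by simp
  rw [(localExpr_eventuallyEq I hx).fderiv_eq, fderiv_comp _
    (by rw [h0]; exact hφ.differentiableAt (by simp))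
    ((contDiffAt_chartChange hx).differentiableAt (by simp)), h0]
  rfl

theorem IsIsometricImmersion.metricCoeffDeriv_eq (hI : IsIsometricImmersion (E := E) I) (x : M)
    (u v w : E) : metricCoeffDeriv x u v w =
      ⟪fderiv ℝ (localExpr I x) (extChartAt 𝓘(ℝ, E) x x) v,
        fderiv ℝ (fderiv ℝ (localExpr I x)) (extChartAt 𝓘(ℝ, E) x x) u w⟫ +
      ⟪fderiv ℝ (fderiv ℝ (localExpr I x)) (extChartAt 𝓘(ℝ, E) x x) u v,
        fderiv ℝ (localExpr I x) (extChartAt 𝓘(ℝ, E) x x) w⟫ := by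
  set y := extChartAt 𝓘(ℝ, E) x x
  have hy : y ∈ (extChartAt 𝓘(ℝ, E) x).target := mem_extChartAt_target x
  have heq : metricCoeff x v w =ᶠ[𝓝 y]
      fun z ↦ ⟪fderiv ℝ (localExpr I x) z v, fderiv ℝ (localExpr I x) z w⟫ := by
    filter_upwards [extChartAt_target_mem_nhds_self x hy] with z hz using hI.metricCoeff_eq x v w hz
  have hL := ((contDiffAt_fderiv (contDiffAt_localExpr hI.contMDiff hy)).differentiableAt
    (by simp)).hasFDerivAt
  have h := (hL.clm_apply (hasFDerivAt_const v y)).inner ℝ (hL.clm_apply (hasFDerivAt_const w y))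
  rw [metricCoeffDeriv, heq.fderiv_eq, h.fderiv]
  simp

variable [FiniteDimensional ℝ E]

/-- The vector `dI(Γ(v, w))` is the tangential part of the second derivative of the immersion. -/
theorem IsIsometricImmersion.christoffel_eq (hI : IsIsometricImmersion (E := E) I) (x : M)
    (v w : E) : christoffel x v w =
      ∑ k, ⟪fderiv ℝ (localExpr I x) (extChartAt 𝓘(ℝ, E) x x) (tangentBasis x k),
        fderiv ℝ (fderiv ℝ (localExpr I x)) (extChartAt 𝓘(ℝ, E) x x) v w⟫ •
          tangentBasis (E := E) x k := by
  have hφ := contDiffAt_localExpr hI.contMDiff (mem_extChartAt_target (I := 𝓘(ℝ, E)) x)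
  have h (u : E) : (metricCoeffDeriv x v w u + metricCoeffDeriv x w v u
      - metricCoeffDeriv (E := E) x u v w) / 2 =
      ⟪fderiv ℝ (localExpr I x) (extChartAt 𝓘(ℝ, E) x x) u,
        fderiv ℝ (fderiv ℝ (localExpr I x)) (extChartAt 𝓘(ℝ, E) x x) v w⟫ := by
    rw [hI.metricCoeffDeriv_eq, hI.metricCoeffDeriv_eq, hI.metricCoeffDeriv_eq,
      fderiv_fderiv_symm hφ w v, fderiv_fderiv_symm hφ u v, fderiv_fderiv_symm hφ u w,
      real_inner_comm (fderiv ℝ (localExpr I x) (extChartAt 𝓘(ℝ, E) x x) u),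
      real_inner_comm (fderiv ℝ (localExpr I x) (extChartAt 𝓘(ℝ, E) x x) w)]
    ring
  refine Finset.sum_congr rfl fun k _ ↦ ?_
  simp only [tangentBasis_apply]
  exact congrArg₂ _ (h _) rfl

/-- Every point of the chart at `x` has a basis of the model space which the local expression of an
isometric immersion maps to an orthonormal frame of the tangent space, namely the coordinates in the
chart at `x` of the orthonormal basis of the tangent space. -/
theorem IsIsometricImmersion.exists_basis (hI : IsIsometricImmersion (E := E) I)
    {x x' : M} (hx : x' ∈ (extChartAt 𝓘(ℝ, E) x).source) :
    ∃ b : Basis (Fin (finrank ℝ (TangentSpace 𝓘(ℝ, E) x'))) ℝ E,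
      (∀ i, b i = fderiv ℝ (extChartAt 𝓘(ℝ, E) x ∘ (extChartAt 𝓘(ℝ, E) x').symm)
        (extChartAt 𝓘(ℝ, E) x' x') (tangentBasis x' i)) ∧
      Orthonormal ℝ fun i ↦ fderiv ℝ (localExpr I x) (extChartAt 𝓘(ℝ, E) x x') (b i) := by
  set J := fderiv ℝ (extChartAt 𝓘(ℝ, E) x ∘ (extChartAt 𝓘(ℝ, E) x').symm)
    (extChartAt 𝓘(ℝ, E) x' x')
  have hJ : Function.Injective J := by
    have h : Function.Injective (fderiv ℝ (localExpr I x) (extChartAt 𝓘(ℝ, E) x x') ∘ J) := by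
      convert injective_of_orthonormal (hI.orthonormal x') using 1
      ext v
      exact (hI.fderiv_comp_chartChange hx v).symm
    exact h.of_comp
  refine ⟨(tangentBasis x').map (LinearEquiv.ofInjectiveEndo J.toLinearMap hJ), fun i ↦ rfl, ?_⟩
  convert hI.orthonormal x' using 2 with i
  exact (hI.fderiv_comp_chartChange hx _).symm

variable [FiniteDimensional ℝ W]

theorem immersionMeanCurvature_eq_starProjection {φ : E → W} {y : E}
    (hy : Function.Injective (fderiv ℝ φ y)) :
    immersionMeanCurvature φ y =
      (LinearMap.range (fderiv ℝ φ y).toLinearMap)ᗮ.starProjection (hessianTrace φ y) := by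
  set R := LinearMap.range (fderiv ℝ φ y).toLinearMap
  obtain ⟨w, ⟨v, hv⟩, z, hz, hvz⟩ := R.exists_add_mem_mem_orthogonal (hessianTrace φ y)
  have h1 : orthogonalLeftInverse (fderiv ℝ φ y) (hessianTrace φ y) = v := by
    rw [hvz, map_add, orthogonalLeftInverse_apply_of_mem_orthogonal hz, add_zero, ← hv]
    exact orthogonalLeftInverse_apply_apply hy v
  have h2 : Rᗮ.starProjection w = 0 := by
    rw [Submodule.starProjection_apply_eq_zero_iff, Submodule.orthogonal_orthogonal]
    exact ⟨v, hv⟩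
  have h3 : fderiv ℝ φ y v = w := hv
  rw [immersionMeanCurvature, h1, h3, hvz, map_add, h2, Submodule.starProjection_eq_self_iff.2 hz,
    zero_add, add_sub_cancel_left]

theorem IsIsometricImmersion.normalSpace_eq (hI : IsIsometricImmersion (E := E) I)
    {x x' : M} (hx : x' ∈ (extChartAt 𝓘(ℝ, E) x).source) :
    normalSpace (E := E) I x' = (LinearMap.range
      (fderiv ℝ (localExpr I x) (extChartAt 𝓘(ℝ, E) x x')).toLinearMap)ᗮ := by
  obtain ⟨b, hb, hb'⟩ := hI.exists_basis hx
  rw [normalSpace, ← ContinuousLinearMap.orthogonal_range]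
  congr 1
  refine Submodule.eq_of_le_of_finrank_eq ?_ ?_
  · rintro _ ⟨v, rfl⟩
    exact ⟨_, ((hI.differential_eq x' v).trans (hI.fderiv_comp_chartChange hx v)).symm⟩
  · have h1 : Function.Injective (differential (E := E) I x') := by
      have h2 := injective_of_orthonormal (hI.orthonormal x')
      exact fun v w h ↦
        h2 ((hI.differential_eq x' v).symm.trans (h.trans (hI.differential_eq x' w)))
    rw [LinearMap.finrank_range_of_inj h1,
      LinearMap.finrank_range_of_inj (injective_of_orthonormal hb')]
    rfl

/-- In the chart at `x`, the mean curvature vector field is that of the local expression of the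
immersion: it does not depend on the charts and orthonormal bases at the nearby points. -/
theorem IsIsometricImmersion.meanCurvature_eq (hI : IsIsometricImmersion (E := E) I)
    {x x' : M} (hx : x' ∈ (extChartAt 𝓘(ℝ, E) x).source) :
    meanCurvature (E := E) I x' =
      immersionMeanCurvature (localExpr I x) (extChartAt 𝓘(ℝ, E) x x') := by
  obtain ⟨b, hb, hb'⟩ := hI.exists_basis hx
  rw [immersionMeanCurvature_eq_starProjection (injective_of_orthonormal hb'),
    hessianTrace_eq_sum hb', map_sum]
  refine Finset.sum_congr rfl fun i _ ↦ ?_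
  set θ := extChartAt 𝓘(ℝ, E) x ∘ (extChartAt 𝓘(ℝ, E) x').symm with hθ
  set y' := extChartAt 𝓘(ℝ, E) x' x' with hy'
  have hθy : θ y' = extChartAt 𝓘(ℝ, E) x x' := by simp [hθ, hy']
  have hφ : ContDiffAt ℝ ∞ (localExpr I x) (θ y') := by
    rw [hθy]
    exact contDiffAt_localExpr hI.contMDiff (PartialEquiv.map_source _ hx)
  have hφ' := contDiffAt_localExpr hI.contMDiff (mem_extChartAt_target (I := 𝓘(ℝ, E)) x')
  have h1 (v : E) : fderiv ℝ (fun y ↦ fderiv ℝ (localExpr I x') y v) y' v =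
      fderiv ℝ (fderiv ℝ (localExpr I x)) (extChartAt 𝓘(ℝ, E) x x') (fderiv ℝ θ y' v)
        (fderiv ℝ θ y' v) + fderiv ℝ (localExpr I x) (extChartAt 𝓘(ℝ, E) x x')
          (fderiv ℝ (fderiv ℝ θ) y' v v) := by
    have h2 := ((contDiffAt_fderiv hφ').differentiableAt (by simp)).hasFDerivAt.clm_apply
      (hasFDerivAt_const v y')
    rw [h2.fderiv, ← hθy, ← fderiv_fderiv_comp hφ (contDiffAt_chartChange hx),
      ← (localExpr_eventuallyEq I hx).fderiv.fderiv_eq]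
    simp
  -- The second derivative of the change of charts contributes a tangential vector only.
  have h3 : secondFundamentalForm (E := E) I x' (tangentBasis (E := E) x' i)
      (tangentBasis (E := E) x' i) =
      (normalSpace (E := E) I x').starProjection
        (fderiv ℝ (fun y ↦ fderiv ℝ (localExpr I x') y (tangentBasis x' i)) y'
          (tangentBasis x' i)) := rfl
  rw [h1, map_add, (Submodule.starProjection_apply_eq_zero_iff
    (K := normalSpace (E := E) I x') (v := fderiv ℝ (localExpr I x) _ _)).2, add_zero, ← hb i] at h3
  · rw [tangentBasis_apply] at h3
    simp only [hI.normalSpace_eq hx] at h3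
    exact h3
  · rw [hI.normalSpace_eq hx, Submodule.orthogonal_orthogonal]
    exact ⟨_, rfl⟩

/-- The normal derivative of the mean curvature vector vanishes if and only if the derivative of its
local expression is orthogonal to the normal space. This includes that the mean curvature vector
field is differentiable, so that its derivative is not a junk value. -/
theorem IsIsometricImmersion.normalConnection_meanCurvature_eq_zero_iff
    (hI : IsIsometricImmersion (E := E) I) (x : M) (v : E) :
    normalConnection (E := E) I (meanCurvature (E := E) I) x v = 0 ↔
      ∀ s ∈ normalSpace (E := E) I x, ⟪fderiv ℝ (immersionMeanCurvature (localExpr I x))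
        (extChartAt 𝓘(ℝ, E) x x) v, s⟫ = 0 := by
  set y := extChartAt 𝓘(ℝ, E) x x
  have hφ := contDiffAt_localExpr hI.contMDiff (mem_extChartAt_target (I := 𝓘(ℝ, E)) x)
  have hsm := contDiffAt_immersionMeanCurvature hφ (injective_of_orthonormal (hI.orthonormal x))
  have h1 : meanCurvature (E := E) I =ᶠ[𝓝 x]
      immersionMeanCurvature (localExpr I x) ∘ extChartAt 𝓘(ℝ, E) x := by
    filter_upwards [extChartAt_source_mem_nhds (I := 𝓘(ℝ, E)) x] with x' hx'
    exact hI.meanCurvature_eq hx'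
  have h2 : MDifferentiableAt 𝓘(ℝ, E) 𝓘(ℝ, W) (meanCurvature (E := E) I) x :=
    (((contMDiffAt_iff_contDiffAt.2 hsm).comp x contMDiffAt_extChartAt).congr_of_eventuallyEq
      h1).mdifferentiableAt (by simp)
  have h3 : localExpr (meanCurvature (E := E) I) x =ᶠ[𝓝 y]
      immersionMeanCurvature (localExpr I x) := by
    filter_upwards [extChartAt_target_mem_nhds_self x (mem_extChartAt_target (I := 𝓘(ℝ, E)) x)]
      with z hz
    rw [localExpr, Function.comp_apply, hI.meanCurvature_eq (PartialEquiv.map_target _ hz),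
      PartialEquiv.right_inv _ hz]
  have h4 : normalConnection (E := E) I (meanCurvature (E := E) I) x v =
      (normalSpace (E := E) I x).starProjection
        (fderiv ℝ (localExpr (meanCurvature (E := E) I) x) y v) :=
    congrArg (normalSpace (E := E) I x).starProjection (mfderiv_eq_fderiv_localExpr h2 v)
  rw [h4, h3.fderiv_eq,
    Submodule.starProjection_apply_eq_zero_iff, Submodule.mem_orthogonal']

end Immersion

end Riemannian

/-! ### The Gauss map -/

namespace Riemannian

open scoped InnerProduct
open ContinuousLinearMap Filter Topology Module

variable {m p N : ℕ} (hN : m + p = N)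
  {M : Type*} [TopologicalSpace M] [ChartedSpace (EuclideanSpace ℝ (Fin m)) M]
  [Bundle.RiemannianBundle (fun x : M ↦ TangentSpace 𝓘(ℝ, EuclideanSpace ℝ (Fin m)) x)]
  {I : M → EuclideanSpace ℝ (Fin N)}
  (hI : IsIsometricImmersion (E := EuclideanSpace ℝ (Fin m)) I)

theorem slope_graph_self (S : Gr p N) (A : Gr.Model p N) : Gr.slope S (Gr.graph S A) = A :=
  (Gr.graphChart S).right_inv (Set.mem_univ A)

/-- The tension field of the Gauss map at `x`, as an element of the model space `Hom(ℝ^p, ℝ^(N-p))`,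
with which the graph chart at `f x` identifies the tangent space of the Grassmannian. -/
noncomputable def gaussTension (x : M) : Gr.Model p N :=
  tensionField (E := EuclideanSpace ℝ (Fin m)) (F := Gr.Model p N) (gaussMap hN hI) x

/-- The tension field of the Gauss map in the chart at `x` and the graph chart at `f x`, where the
Christoffel symbols of the Grassmannian vanish. -/
theorem gaussTension_eq {x : M} {A : EuclideanSpace ℝ (Fin m) → Gr.Model p N}
    (hA : ∀ᶠ y in 𝓝 (extChartAt 𝓘(ℝ, EuclideanSpace ℝ (Fin m)) x x),
      gaussMap hN hI ((extChartAt 𝓘(ℝ, EuclideanSpace ℝ (Fin m)) x).symm y) =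
        Gr.graph (gaussMap hN hI x) (A y)) :
    gaussTension hN hI x =
      ∑ i, (fderiv ℝ (fderiv ℝ A) (extChartAt 𝓘(ℝ, EuclideanSpace ℝ (Fin m)) x x)
        (tangentBasis x i) (tangentBasis x i) -
        fderiv ℝ A (extChartAt 𝓘(ℝ, EuclideanSpace ℝ (Fin m)) x x)
          (christoffel x (tangentBasis (E := EuclideanSpace ℝ (Fin m)) x i)
            (tangentBasis (E := EuclideanSpace ℝ (Fin m)) x i))) := by
  have h1 : writtenInExtChartAt 𝓘(ℝ, EuclideanSpace ℝ (Fin m)) 𝓘(ℝ, Gr.Model p N) x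
      (gaussMap hN hI) =ᶠ[𝓝 (extChartAt 𝓘(ℝ, EuclideanSpace ℝ (Fin m)) x x)] A := by
    filter_upwards [hA] with y hy
    change Gr.slope (gaussMap hN hI x) (gaussMap hN hI _) = A y
    rw [hy, slope_graph_self]
  have h2 (v : EuclideanSpace ℝ (Fin m)) :
      mapHessian (E := EuclideanSpace ℝ (Fin m)) (F := Gr.Model p N) (gaussMap hN hI) x v v =
      (fderiv ℝ (fderiv ℝ A) (extChartAt 𝓘(ℝ, EuclideanSpace ℝ (Fin m)) x x) v v -
        fderiv ℝ A (extChartAt 𝓘(ℝ, EuclideanSpace ℝ (Fin m)) x x) (christoffel x v v) :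
        Gr.Model p N) := by
    set φ := writtenInExtChartAt 𝓘(ℝ, EuclideanSpace ℝ (Fin m)) 𝓘(ℝ, Gr.Model p N) x
      (gaussMap hN hI)
    set y := extChartAt 𝓘(ℝ, EuclideanSpace ℝ (Fin m)) x x
    have h3 : (fderiv ℝ (fderiv ℝ φ) y v v - fderiv ℝ φ y (christoffel x v v) +
        christoffel (gaussMap hN hI x) (fderiv ℝ φ y v) (fderiv ℝ φ y v) : Gr.Model p N) =
        fderiv ℝ (fderiv ℝ A) y v v - fderiv ℝ A y (christoffel x v v) := by
      rw [Gr.christoffel_eq_zero, add_zero, h1.fderiv.fderiv_eq, h1.fderiv_eq]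
    exact h3
  have h4 : gaussTension hN hI x = ∑ i, (mapHessian (E := EuclideanSpace ℝ (Fin m))
      (F := Gr.Model p N) (gaussMap hN hI) x (tangentBasis (E := EuclideanSpace ℝ (Fin m)) x i)
      (tangentBasis (E := EuclideanSpace ℝ (Fin m)) x i) : Gr.Model p N) := by
    simp only [tangentBasis_apply]
    rfl
  rw [h4]
  exact Finset.sum_congr rfl fun i _ ↦ h2 _

variable [IsManifold 𝓘(ℝ, EuclideanSpace ℝ (Fin m)) ∞ M]

theorem mem_gaussMap_iff {x x' : M}
    (hx : x' ∈ (extChartAt 𝓘(ℝ, EuclideanSpace ℝ (Fin m)) x).source)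
    (w : EuclideanSpace ℝ (Fin N)) :
    w ∈ (gaussMap hN hI x').1 ↔ ∀ u, ⟪fderiv ℝ (localExpr I x)
      (extChartAt 𝓘(ℝ, EuclideanSpace ℝ (Fin m)) x x') u, w⟫ = 0 := by
  change w ∈ normalSpace (E := EuclideanSpace ℝ (Fin m)) I x' ↔ _
  rw [hI.normalSpace_eq hx, Submodule.mem_orthogonal]
  exact ⟨fun h u ↦ h _ ⟨u, rfl⟩, by rintro h _ ⟨u, rfl⟩; exact h u⟩

theorem mem_orthogonal_gaussMap_iff (x : M) (w : EuclideanSpace ℝ (Fin N)) :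
    w ∈ (gaussMap hN hI x).1ᗮ ↔ w ∈ LinearMap.range (fderiv ℝ (localExpr I x)
      (extChartAt 𝓘(ℝ, EuclideanSpace ℝ (Fin m)) x x)).toLinearMap := by
  change w ∈ (normalSpace (E := EuclideanSpace ℝ (Fin m)) I x)ᗮ ↔ _
  rw [hI.normalSpace_eq (mem_extChartAt_source (I := 𝓘(ℝ, EuclideanSpace ℝ (Fin m))) x),
    Submodule.orthogonal_orthogonal]

/-- In graph coordinates, the normal space at a nearby point is the graph of the solution `A` of the
equation `L† ∘ (frame + coframe ∘ A) = 0`, where `L` is the differential of the immersion. -/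
theorem exists_gaussMap_eq_graph (x : M) :
    ∃ A : EuclideanSpace ℝ (Fin m) → Gr.Model p N,
      ContDiffAt ℝ ∞ A (extChartAt 𝓘(ℝ, EuclideanSpace ℝ (Fin m)) x x) ∧
      ∀ᶠ y in 𝓝 (extChartAt 𝓘(ℝ, EuclideanSpace ℝ (Fin m)) x x),
        gaussMap hN hI ((extChartAt 𝓘(ℝ, EuclideanSpace ℝ (Fin m)) x).symm y) =
          Gr.graph (gaussMap hN hI x) (A y) := by
  set S := gaussMap hN hI x
  set e := extChartAt 𝓘(ℝ, EuclideanSpace ℝ (Fin m)) x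
  have he : e x ∈ e.target := mem_extChartAt_target x
  set L := fderiv ℝ (localExpr (E := EuclideanSpace ℝ (Fin m)) I x)
  set U := fun y ↦ (L y)† ∘L Gr.coframe S
  set A : EuclideanSpace ℝ (Fin m) → Gr.Model p N :=
    fun y ↦ -(ContinuousLinearMap.inverse (U y) ∘L ((L y)† ∘L Gr.frame S))
  have hmem (w) : w ∈ S.1 ↔ ∀ u, ⟪L (e x) u, w⟫ = 0 :=
    mem_gaussMap_iff hN hI (mem_extChartAt_source x) w
  have hU0 : Function.Injective (U (e x)) := by
    rw [injective_iff_map_eq_zero]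
    intro v hv
    have h1 : Gr.coframe S v ∈ S.1 := by
      rw [hmem]
      intro u
      rw [← adjoint_inner_right]
      change ⟪u, U (e x) v⟫ = 0
      rw [hv, inner_zero_right]
    have h2 := S.1.inner_right_of_mem_orthogonal h1 (Gr.coframe_mem S v)
    rw [Gr.inner_coframe] at h2
    exact inner_self_eq_zero.1 h2
  have hdim : finrank ℝ (EuclideanSpace ℝ (Fin (N - p))) =
      finrank ℝ (EuclideanSpace ℝ (Fin m)) := by
    rw [finrank_euclideanSpace_fin, finrank_euclideanSpace_fin]
    omega
  obtain ⟨g, hg⟩ : ∃ g : EuclideanSpace ℝ (Fin (N - p)) ≃L[ℝ] EuclideanSpace ℝ (Fin m),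
      (g : EuclideanSpace ℝ (Fin (N - p)) →L[ℝ] EuclideanSpace ℝ (Fin m)) = U (e x) :=
    ⟨(LinearEquiv.ofInjectiveOfFinrankEq (U (e x)).toLinearMap hU0 hdim).toContinuousLinearEquiv,
      by ext1 v; rfl⟩
  have hLs : ContDiffAt ℝ ∞ (fun y ↦ (L y)†) (e x) :=
    contDiff_adjoint.contDiffAt.comp _
      (contDiffAt_fderiv (contDiffAt_localExpr hI.contMDiff he))
  have hUs : ContDiffAt ℝ ∞ U (e x) := hLs.clm_comp contDiffAt_const
  have hinv : ContDiffAt ℝ ∞ (fun y ↦ ContinuousLinearMap.inverse (U y)) (e x) := by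
    have h1 : ContDiffAt ℝ ∞ ContinuousLinearMap.inverse (U (e x)) := by
      rw [← hg]
      exact contDiffAt_map_inverse g
    exact h1.comp _ hUs
  refine ⟨A, (hinv.clm_comp (hLs.clm_comp contDiffAt_const)).neg, ?_⟩
  have hUinv : ∀ᶠ y in 𝓝 (e x), U y ∈ Set.range
      ((↑) : (EuclideanSpace ℝ (Fin (N - p)) ≃L[ℝ] EuclideanSpace ℝ (Fin m)) → _) :=
    hUs.continuousAt.eventually (by rw [← hg]; exact ContinuousLinearEquiv.nhds g)
  filter_upwards [hUinv, extChartAt_target_mem_nhds_self x he] with y ⟨g', hg'⟩ hy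
  refine Subtype.ext (Submodule.eq_of_le_of_finrank_eq ?_
    ((Gr.graph S (A y)).2.trans (gaussMap hN hI (e.symm y)).2.symm)).symm
  rintro _ ⟨v, rfl⟩
  rw [mem_gaussMap_iff hN hI (e.map_target hy)]
  intro u
  rw [PartialEquiv.right_inv _ hy, ← adjoint_inner_right]
  have h1 : ((L y)†) (Gr.coframe S (A y v)) = - ((L y)†) (Gr.frame S v) := by
    change U y (-(ContinuousLinearMap.inverse (U y)) (((L y)†) (Gr.frame S v))) = _
    rw [← hg', ContinuousLinearMap.inverse_equiv]
    simp
  have h2 : ((L y)†) (Gr.graphMap S (A y) v) = 0 := by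
    change ((L y)†) (Gr.frame S v + Gr.coframe S (A y v)) = 0
    rw [map_add, h1, add_neg_cancel]
  exact (congrArg _ h2).trans (inner_zero_right _)

theorem contMDiff_gaussMap :
    ContMDiff 𝓘(ℝ, EuclideanSpace ℝ (Fin m)) 𝓘(ℝ, Gr.Model p N) ∞ (gaussMap hN hI) := by
  intro x
  obtain ⟨A, hA, hgr⟩ := exists_gaussMap_eq_graph hN hI x
  have h1 : gaussMap hN hI =ᶠ[𝓝 x] (extChartAt 𝓘(ℝ, Gr.Model p N) (gaussMap hN hI x)).symm ∘
      A ∘ extChartAt 𝓘(ℝ, EuclideanSpace ℝ (Fin m)) x := by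
    filter_upwards
      [(continuousAt_extChartAt (I := 𝓘(ℝ, EuclideanSpace ℝ (Fin m))) x).eventually hgr,
      extChartAt_source_mem_nhds (I := 𝓘(ℝ, EuclideanSpace ℝ (Fin m))) x] with x' h2 h3
    rw [PartialEquiv.left_inv _ h3] at h2
    exact h2
  refine ContMDiffAt.congr_of_eventuallyEq ?_ h1
  refine ContMDiffAt.comp (I' := 𝓘(ℝ, Gr.Model p N)) x (contMDiffAt_extChartAt_symm ?_)
    ((contMDiffAt_iff_contDiffAt.2 hA).comp x contMDiffAt_extChartAt)
  rw [Gr.extChartAt_target]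
  trivial

/-- The tension field `τ`, an element of `Hom(S, Sᗮ)` for the normal space `S` at `x`, is minus the
adjoint of the normal derivative of the mean curvature vector, an element of `Hom(Sᗮ, S)`. The proof
applies `inner_laplacian_normal` to the normal fields `y ↦ v + A y v` given by the graphs. -/
theorem inner_gaussTension (x : M) (a : EuclideanSpace ℝ (Fin m))
    (v : EuclideanSpace ℝ (Fin p)) :
    ⟪fderiv ℝ (localExpr I x) (extChartAt 𝓘(ℝ, EuclideanSpace ℝ (Fin m)) x x) a,
      Gr.coframe (gaussMap hN hI x) (gaussTension hN hI x v)⟫ =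
    - ⟪fderiv ℝ (immersionMeanCurvature (localExpr I x))
      (extChartAt 𝓘(ℝ, EuclideanSpace ℝ (Fin m)) x x) a, Gr.frame (gaussMap hN hI x) v⟫ := by
  obtain ⟨A, hA, hgr⟩ := exists_gaussMap_eq_graph hN hI x
  rw [gaussTension_eq hN hI hgr]
  simp_rw [hI.christoffel_eq]
  set S := gaussMap hN hI x
  set y := extChartAt 𝓘(ℝ, EuclideanSpace ℝ (Fin m)) x x
  have hy : y ∈ (extChartAt 𝓘(ℝ, EuclideanSpace ℝ (Fin m)) x).target := mem_extChartAt_target x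
  have hφ := contDiffAt_localExpr hI.contMDiff hy
  have hA0 : A y = 0 := by
    rw [← slope_graph_self S (A y), ← hgr.self_of_nhds, extChartAt_to_inv]
    exact Gr.extChartAt_self S
  set ℓ : Gr.Model p N →L[ℝ] EuclideanSpace ℝ (Fin N) :=
    Gr.coframe S ∘L ContinuousLinearMap.apply ℝ _ v
  set g : Gr.Model p N → EuclideanSpace ℝ (Fin N) := fun B ↦ Gr.frame S v + ℓ B
  have hgd (B : Gr.Model p N) : HasFDerivAt g ℓ B := ℓ.hasFDerivAt.const_add _
  have hgd' : fderiv ℝ g = fun _ ↦ ℓ := funext fun B ↦ (hgd B).fderiv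
  have hgs (B : Gr.Model p N) : ContDiffAt ℝ ∞ g B := contDiffAt_const.add ℓ.contDiff.contDiffAt
  have h1 (a : EuclideanSpace ℝ (Fin m)) : fderiv ℝ (g ∘ A) y a = ℓ (fderiv ℝ A y a) := by
    rw [((hgd _).comp y (hA.differentiableAt (by simp)).hasFDerivAt).fderiv]
    rfl
  have h2 (a : EuclideanSpace ℝ (Fin m)) :
      fderiv ℝ (fderiv ℝ (g ∘ A)) y a a = ℓ (fderiv ℝ (fderiv ℝ A) y a a) := by
    rw [fderiv_fderiv_comp (hgs _) hA, hgd']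
    simp
  have hnormal : ∀ᶠ z in 𝓝 y, ∀ u, ⟪fderiv ℝ (localExpr I x) z u, (g ∘ A) z⟫ = 0 := by
    filter_upwards [hgr, extChartAt_target_mem_nhds_self x hy] with z hz hzt
    have h3 : (g ∘ A) z ∈ (Gr.graph S (A z)).1 := ⟨v, rfl⟩
    rw [← hz, mem_gaussMap_iff hN hI (PartialEquiv.map_target _ hzt),
      PartialEquiv.right_inv _ hzt] at h3
    exact h3
  have htan (a : EuclideanSpace ℝ (Fin m)) : fderiv ℝ (g ∘ A) y a ∈
      LinearMap.range (fderiv ℝ (localExpr I x) y).toLinearMap := by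
    rw [h1, ← mem_orthogonal_gaussMap_iff hN hI]
    exact Gr.coframe_mem S _
  have key := inner_laplacian_normal hφ ((hgs _).comp y hA) hnormal (hI.orthonormal x) htan a
  simp only [h1, h2, ← map_sub, ← map_sum] at key
  rw [show (g ∘ A) y = Gr.frame S v by simp [g, hA0]] at key
  exact key

theorem normalConnection_meanCurvature_eq_zero_iff_gaussTension (x : M) :
    (∀ a, normalConnection (E := EuclideanSpace ℝ (Fin m)) I
      (meanCurvature (E := EuclideanSpace ℝ (Fin m)) I) x a = 0) ↔
    gaussTension hN hI x = 0 := by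
  set S := gaussMap hN hI x
  have hmem (w) := mem_gaussMap_iff hN hI
    (mem_extChartAt_source (I := 𝓘(ℝ, EuclideanSpace ℝ (Fin m))) x) w
  have key := inner_gaussTension hN hI x
  constructor
  · intro h
    ext1 v
    have h1 : Gr.coframe S (gaussTension hN hI x v) ∈ S.1 := by
      rw [hmem]
      intro a
      rw [key, (hI.normalConnection_meanCurvature_eq_zero_iff x a).1 (h a) _ (Gr.frame_mem S v),
        neg_zero]
    have h2 := S.1.inner_right_of_mem_orthogonal h1 (Gr.coframe_mem S (gaussTension hN hI x v))
    rw [Gr.inner_coframe] at h2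
    exact inner_self_eq_zero.1 h2
  · intro h a
    refine (hI.normalConnection_meanCurvature_eq_zero_iff x a).2 fun s hs ↦ ?_
    have hs' : s ∈ S.1 := hs
    rw [← Gr.range_frame] at hs'
    obtain ⟨v, rfl⟩ := hs'
    have h1 := key a v
    rw [h] at h1
    have h2 : Gr.coframe S ((0 : Gr.Model p N) v) = 0 := by simp
    exact neg_eq_zero.1 (h1.symm.trans ((congrArg _ h2).trans (inner_zero_right _)))

end Riemannian

theorem mainTheorem9 {m p N : ℕ} (hN : m + p = N)
    {M : Type*} [TopologicalSpace M] [ChartedSpace (EuclideanSpace ℝ (Fin m)) M]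
    [IsManifold 𝓘(ℝ, EuclideanSpace ℝ (Fin m)) ∞ M]
    [Bundle.RiemannianBundle (fun x : M ↦ TangentSpace 𝓘(ℝ, EuclideanSpace ℝ (Fin m)) x)]
    [IsContMDiffRiemannianBundle 𝓘(ℝ, EuclideanSpace ℝ (Fin m)) ∞ (EuclideanSpace ℝ (Fin m))
      (fun x : M ↦ TangentSpace 𝓘(ℝ, EuclideanSpace ℝ (Fin m)) x)]
    (I : M → EuclideanSpace ℝ (Fin N))
    (hI : Riemannian.IsIsometricImmersion (E := EuclideanSpace ℝ (Fin m)) I) :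
    Riemannian.HasParallelMeanCurvature (E := EuclideanSpace ℝ (Fin m)) I ↔
      Riemannian.IsHarmonicMap (E := EuclideanSpace ℝ (Fin m)) (F := Gr.Model p N)
        (Riemannian.gaussMap hN hI) := by
  have h (x : M) := Riemannian.normalConnection_meanCurvature_eq_zero_iff_gaussTension
    hN hI x
  exact ⟨fun hp ↦ ⟨Riemannian.contMDiff_gaussMap hN hI, fun x ↦ (h x).1 (hp x)⟩,
    fun hh x ↦ (h x).2 (hh.2 x)⟩
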